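/- Let $S=[0,1]^p$, $A=[0,1]^q$ and $K=S\times A=[0,1]^{\dim K}$, $\dim K=p+q$, all with the $\ell_\infty$-metric. For a Lipschitz function $f$ on $S$ or on $K$ let $\|f\|_{\mathrm L}=\max\{\sup_x|f(x)|,\ \sup_{x\ne y}|f(x)-f(y)|/\|x-y\|_{\ell_\infty}\}$. Let $Q$ be a stochastic kernel on $S$ given $K$, write $Qu(k)=\int_S u(s')\,Q(\mathrm ds'|k)$, and let $L_Q>0$ be such that $|Qu(k)-Qu(k')|\le L_Q\|u\|_\infty\|k-k'\|_{\ell_\infty}$ for all $k,k'\in K$ and all continuous $u:S\to\mathbb R$. Let the one-stage cost $\psi:K\to[0,\infty)$ be Lipschitz continuous. Let $n\ge1$, let $u_1,\dots,u_n$ be linearly independent Lipschitz functions on $S$ with $\|u_i\|_{\mathrm L}=1$, let $\|\cdot\|_{\mathfrak R}$ be a norm on $\mathbb R^n$, $\theta_{\mathcal P}>0$, and $\varrho_n=\sup_{\|\alpha\|_{\mathfrak R}\le1}\|\alpha\|_{\ell_1}$. Define $J^{\mathrm{AC}}_n$ by $$-J^{\mathrm{AC}}_n=\inf_{(\rho,\alpha)\in\mathbb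 R\times\mathbb R^n}\Big\{-\rho\ :\ \rho+\sum_{i=1}^n\alpha_i\big(u_i(s)-Qu_i(s,a)\big)\le\psi(s,a)\ \ \forall (s,a)\in K,\quad \|\alpha\|_{\mathfrak R}\le\theta_{\mathcal P}\Big\},$$ and, for state-action pairs $(s_1,a_1),\dots,(s_N,a_N)\in K$, define $J^{\mathrm{AC}}_{n,N}$ by the same program with the first constraint imposed only at $(s,a)=(s_j,a_j)$, $j=1,\dots,N$. Put $$z_n=\big(\theta_{\mathcal P}\varrho_n(\max\{L_Q,1\}+1)+\|\psi\|_{\mathrm L}\big)^{-1},\qquad \mathsf N(m,\delta,\beta)=\min\Big\{N\in\mathbb N:\ \sum_{i=0}^{m-1}\binom Ni\delta^i(1-\delta)^{N-i}\le\beta\Big\}.$$ Then for all $\varepsilon,\beta\in(0,1)$ and all $N\ge\mathsf N\big(n+1,(z_n\varepsilon)^{\dim K},\beta\big)$, if $(s_j,a_j)_{j\le N}$ are i.i.d. samples from the uniform distribution $\mathbb P$ on $K$, then $$\mathbb P^N\big[\,0\le J^{\mathrm{AC}}_{n,N}-J^{\mathrm{AC}}_n\le\varepsilon\,\big]\ge1-\beta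 .$$ -/

import Mathlib

open MeasureTheory ProbabilityTheory

namespace MDP

/-- The unit hypercube `[0,1]^d`; its metric is the `ℓ_∞` one and its `volume` is the uniform
probability distribution. -/
abbrev Cube (d : ℕ) : Type := Fin d → unitInterval

/-- The state-action set `K = S × A = [0,1]^(p+q)` with `S = [0,1]^p` and `A = [0,1]^q`, again
with the `ℓ_∞` metric and with the uniform distribution as `volume`. -/
abbrev StateAction (p q : ℕ) : Type := Cube p × Cube q

/-- The Lipschitz norm `‖f‖_L = sup {|f x|, |f x - f y| / dist x y}` of a bounded Lipschitz
function. -/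
noncomputable def lipNorm {X : Type*} [PseudoMetricSpace X] (f : X → ℝ) : ℝ :=
  max (⨆ x : X, |f x|) (⨆ z : X × X, |f z.1 - f z.2| / dist z.1 z.2)

/-- The action `Qu(k) = ∫ u(s') Q(ds' | k)` of a transition law on a function of the state. -/
noncomputable def act {p q : ℕ} (Q : Kernel (StateAction p q) (Cube p)) (u : Cube p → ℝ)
    (k : StateAction p q) : ℝ :=
  ∫ s, u s ∂(Q k)

/-- The equivalence ratio `ϱ_n = sup {‖α‖_{ℓ_1} : ‖α‖_R ≤ 1}`. -/
noncomputable def normRatio {n : ℕ} (R : Seminorm ℝ (Fin n → ℝ)) : ℝ :=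
  sSup {r : ℝ | ∃ α : Fin n → ℝ, R α ≤ 1 ∧ r = ∑ i, |α i|}

/-- The sample size `min {N : ∑_{i<m} (N choose i) δ^i (1-δ)^(N-i) ≤ β}`. -/
noncomputable def sampleSize (m : ℕ) (δ β : ℝ) : ℕ :=
  sInf {N : ℕ | ∑ i ∈ Finset.range m, (N.choose i : ℝ) * δ ^ i * (1 - δ) ^ (N - i) ≤ β}

section Program

variable {p q n : ℕ} {ι : Type*}

/-- `(ρ, α)` satisfies `‖α‖_R ≤ θ` and
`ρ + ∑ i, α_i (u_i(s) - Qu_i(s,a)) ≤ ψ(s,a)` at each of the points `(s,a) = pt j`. -/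
def Feasible (Q : Kernel (StateAction p q) (Cube p)) (ψ : StateAction p q → ℝ)
    (u : Fin n → Cube p → ℝ) (R : Seminorm ℝ (Fin n → ℝ)) (θ : ℝ)
    (pt : ι → StateAction p q) (ρ : ℝ) (α : Fin n → ℝ) : Prop :=
  (∀ j, ρ + ∑ i, α i * (u i (pt j).1 - act Q (u i) (pt j)) ≤ ψ (pt j)) ∧ R α ≤ θ

/-- The number `J` such that `-J = inf {-ρ : (ρ, α) feasible}`, with one constraint for each of
the points `pt j`. -/
noncomputable def programValue (Q : Kernel (StateAction p q) (Cube p))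
    (ψ : StateAction p q → ℝ) (u : Fin n → Cube p → ℝ) (R : Seminorm ℝ (Fin n → ℝ)) (θ : ℝ)
    (pt : ι → StateAction p q) : ℝ :=
  -sInf {v : ℝ | ∃ (ρ : ℝ) (α : Fin n → ℝ), Feasible Q ψ u R θ pt ρ α ∧ v = -ρ}

/-- `J^AC_n`: the semi-infinite program, with a constraint at every state-action pair. -/
noncomputable def semiInfiniteValue (Q : Kernel (StateAction p q) (Cube p))
    (ψ : StateAction p q → ℝ) (u : Fin n → Cube p → ℝ) (R : Seminorm ℝ (Fin n → ℝ))
    (θ : ℝ) : ℝ :=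
  programValue Q ψ u R θ (fun k : StateAction p q => k)

/-- `J^AC_{n,N}`: the sampled program, with a constraint at each sample `ω j`. -/
noncomputable def sampledValue {N : ℕ} (Q : Kernel (StateAction p q) (Cube p))
    (ψ : StateAction p q → ℝ) (u : Fin n → Cube p → ℝ) (R : Seminorm ℝ (Fin n → ℝ))
    (θ : ℝ) (ω : Fin N → StateAction p q) : ℝ :=
  programValue Q ψ u R θ ω

/-- A norm on `ℝ^n` dominates a multiple of the `ℓ_1` norm. -/
theorem exists_l1_le (R : Seminorm ℝ (Fin n → ℝ)) (hR : ∀ α, R α = 0 → α = 0) :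
    ∃ C : ℝ, 0 ≤ C ∧ ∀ α : Fin n → ℝ, ∑ i, |α i| ≤ C * R α := by
  have hc : Continuous R :=
    continuousOn_univ.1 (R.convexOn.continuousOn isOpen_univ)
  have hl : Continuous fun α : Fin n → ℝ => ∑ i, |α i| := by fun_prop
  have hK : IsCompact (Metric.sphere (0 : Fin n → ℝ) 1) := isCompact_sphere 0 1
  obtain ⟨C, hC⟩ : BddAbove ((fun α => (∑ i, |α i|) / R α) '' Metric.sphere (0 : Fin n → ℝ) 1) := by
    refine hK.bddAbove_image (hl.continuousOn.div hc.continuousOn fun α hα h0 => ?_)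
    have h1 := hR α h0
    rw [h1] at hα
    simp at hα
  refine ⟨max C 0, le_max_right _ _, fun α => ?_⟩
  by_cases hα : α = 0
  · simp [hα]
  have hn : 0 < ‖α‖ := norm_pos_iff.2 hα
  have hp : 0 < R α := lt_of_le_of_ne (apply_nonneg R α) fun h => hα (hR α h.symm)
  have h1 := hC ⟨‖α‖⁻¹ • α, by simp [norm_smul, hn.ne'], rfl⟩
  have h2 : (∑ i, |(‖α‖⁻¹ • α) i|) / R (‖α‖⁻¹ • α) = (∑ i, |α i|) / R α := by
    simp only [Pi.smul_apply, smul_eq_mul, abs_mul, abs_inv, abs_norm, map_smul_eq_mul, norm_inv,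
      norm_norm, ← Finset.mul_sum]
    exact mul_div_mul_left _ _ (inv_ne_zero hn.ne')
  simp only [h2] at h1
  exact (div_le_iff₀ hp).1 (h1.trans (le_max_left _ _))

/-- The set that defines `normRatio` is bounded, so that the supremum there is genuine. -/
theorem bddAbove_normRatio (R : Seminorm ℝ (Fin n → ℝ)) (hR : ∀ α, R α = 0 → α = 0) :
    BddAbove {r : ℝ | ∃ α : Fin n → ℝ, R α ≤ 1 ∧ r = ∑ i, |α i|} := by
  obtain ⟨C, hC0, hC⟩ := exists_l1_le R hR
  refine ⟨C, ?_⟩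
  rintro r ⟨α, hα, rfl⟩
  exact (hC α).trans (mul_le_of_le_one_right hC0 hα)

/-- With at least one constraint point, the infimum in `programValue` is genuine. -/
theorem isGLB_programValue [Nonempty ι] (Q : Kernel (StateAction p q) (Cube p))
    (ψ : StateAction p q → ℝ) (hψ : ∀ k, 0 ≤ ψ k) (u : Fin n → Cube p → ℝ)
    (R : Seminorm ℝ (Fin n → ℝ)) (hR : ∀ α, R α = 0 → α = 0) (θ : ℝ) (hθ : 0 ≤ θ)
    (pt : ι → StateAction p q) :
    IsGLB {v : ℝ | ∃ (ρ : ℝ) (α : Fin n → ℝ), Feasible Q ψ u R θ pt ρ α ∧ v = -ρ}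
      (-programValue Q ψ u R θ pt) := by
  obtain ⟨C, hC0, hC⟩ := exists_l1_le R hR
  obtain ⟨j⟩ := ‹Nonempty ι›
  have key : ∀ w : Fin n → ℝ, ∀ α : Fin n → ℝ, R α ≤ θ →
      -(C * θ * ∑ i, |w i|) ≤ ∑ i, α i * w i := by
    intro w α hα
    refine neg_le_of_abs_le ((Finset.abs_sum_le_sum_abs _ _).trans ?_)
    rw [Finset.mul_sum]
    refine Finset.sum_le_sum fun i _ => ?_
    rw [abs_mul]
    refine mul_le_mul_of_nonneg_right ?_ (abs_nonneg _)
    exact (Finset.single_le_sum (f := fun i => |α i|) (fun i _ => abs_nonneg (α i))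
      (Finset.mem_univ i)).trans ((hC α).trans (mul_le_mul_of_nonneg_left hα hC0))
  rw [programValue, neg_neg]
  refine isGLB_csInf ⟨0, 0, 0, ⟨fun k => by simpa using hψ _, by simpa using hθ⟩, by simp⟩
    ⟨-(ψ (pt j) + C * θ * ∑ i, |u i (pt j).1 - act Q (u i) (pt j)|), ?_⟩
  rintro v ⟨ρ, α, ⟨h1, h2⟩, rfl⟩
  have h3 := h1 j
  have h4 := key (fun i => u i (pt j).1 - act Q (u i) (pt j)) α h2
  linarith

end Program

end MDP

/-! The sampled program relaxes the full one, so the gap is nonnegative. For the upper bound,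
eliminate `ρ`: each value is the maximum over the ball `R α ≤ θ` of a minimum of constraint
functions `ψ(k) - ∑ α_i w_i(k)`, with `w_i(s,a) = u_i(s) - Qu_i(s,a)`. Two facts are needed: a
scenario bound saying that the sampled optimizer violates only a small proportion of constraints,
and a Lipschitz estimate turning small violation volume into small violation size.

The scenario bound requires nondegeneracy, which the program may lack. So each sample carries an
independent uniform label `s`, and `τ s - τ ∑ α_i²` is added to its constraint function. Strict
concavity makes maximizers unique; the labels make redundant constraints almost surely slack
(`ae_slack`) and also break ties. The resulting value is a function on finite sets of constraints
with locality (`maxMin_union_eq`) and, by Helly's theorem, combinatorial dimension at most `n + 1`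
(`exists_basis_maxMin`). Nondegeneracy yields one minimal set determining the value; padding it with
the smallest remaining labels gives, almost surely, exactly one compatible subsample of size `n + 1`
(`existsUnique_padded_basis`).

Let `V` be the violation probability of a random subsample of size `k + 1`, where `k = n`. Given the
subsample, the other `N - (k+1)` points are all compatible with probability `(1-V)^(N-(k+1))`.
Uniqueness therefore gives `(N choose k+1) E[(1-V)^(N-(k+1))] = 1` for every `N ≥ k + 1`. These
moments force `V` to have the Beta density `(k+1) v^k`, whose partial moments are exactly the
binomial tails.

Finally, if the violation set has volume at most `(ε/Λ)^(p+q)`, with `Λ = 1/z_n` a common Lipschitz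
constant of the constraint functions, no constraint is violated by more than `ε`: otherwise a ball
of larger volume would be violated. Lowering `ρ` by `ε` restores feasibility, and the error of order
`τ` vanishes in the limit. -/

/-! ### Binomial tails: recursion, monotonicity, limit and integral representation. -/

/-- The lower tail `P[X < m]` of a binomial variable with `N` trials and success probability `x`. -/
noncomputable def binomialTail (m N : ℕ) (x : ℝ) : ℝ :=
  ∑ i ∈ Finset.range m, (N.choose i : ℝ) * x ^ i * (1 - x) ^ (N - i)

theorem binomialTail_eq_one {m N : ℕ} (h : N < m) (x : ℝ) : binomialTail m N x = 1 := by
  have h1 : (x + (1 - x)) ^ N = 1 := by simp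
  rw [add_pow] at h1
  refine Eq.trans ?_ h1
  rw [binomialTail, eq_comm]
  refine Finset.sum_subset_zero_on_sdiff (Finset.range_subset_range.2 h) (fun i hi => ?_)
    fun i _ => by ring
  have : N.choose i = 0 := Nat.choose_eq_zero_of_lt (by
    simp only [Finset.mem_sdiff, Finset.mem_range] at hi; omega)
  simp [this]

theorem binomialTail_zero_right {m : ℕ} (hm : 0 < m) (N : ℕ) : binomialTail m N 0 = 1 := by
  obtain ⟨k, rfl⟩ := Nat.exists_eq_succ_of_ne_zero hm.ne'
  simp [binomialTail, Finset.sum_range_succ']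

theorem binomialTail_one_right {m N : ℕ} (h : m ≤ N) : binomialTail m N 1 = 0 := by
  refine Finset.sum_eq_zero fun i hi => ?_
  have : N - i ≠ 0 := by have := Finset.mem_range.1 hi; omega
  simp [this]

theorem binomialTail_mono_left {m m' : ℕ} (h : m ≤ m') (N : ℕ) {x : ℝ} (h0 : 0 ≤ x) (h1 : x ≤ 1) :
    binomialTail m N x ≤ binomialTail m' N x := by
  refine Finset.sum_le_sum_of_subset_of_nonneg (Finset.range_subset_range.2 h) fun i _ _ => ?_
  have : 0 ≤ 1 - x := by linarith
  positivity

/-- Condition on the outcome of one trial; algebraically this is Pascal's rule and induction on `m`.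
-/
theorem binomialTail_succ_succ (m N : ℕ) (x : ℝ) :
    binomialTail (m + 1) (N + 1) x
      = (1 - x) * binomialTail (m + 1) N x + x * binomialTail m N x := by
  induction m with
  | zero => simp [binomialTail, pow_succ, mul_comm]
  | succ m ih =>
    rw [binomialTail, Finset.sum_range_succ, ← binomialTail, ih]
    conv_rhs => rw [binomialTail, Finset.sum_range_succ, ← binomialTail]
    have e : binomialTail (m + 1) N x
        = binomialTail m N x + (N.choose m : ℝ) * x ^ m * (1 - x) ^ (N - m) := by
      simp only [binomialTail, Finset.sum_range_succ]
    rw [e, Nat.choose_succ_succ]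
    rcases lt_or_ge N (m + 1) with h | h
    · rw [Nat.choose_eq_zero_of_lt h]
      simp only [Nat.add_sub_add_right]
      push_cast
      ring
    · have e1 : N + 1 - (m + 1) = (N - (m + 1)) + 1 := by omega
      have e2 : N - m = (N - (m + 1)) + 1 := by omega
      rw [e1, e2]
      push_cast
      ring

theorem binomialTail_antitone (m : ℕ) {x : ℝ} (h0 : 0 ≤ x) (h1 : x ≤ 1) :
    Antitone fun N => binomialTail m N x := by
  refine antitone_nat_of_succ_le fun N => ?_
  cases m with
  | zero => simp [binomialTail]
  | succ m =>
    rw [binomialTail_succ_succ]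
    have := binomialTail_mono_left (Nat.le_succ m) N h0 h1
    simp only [Nat.succ_eq_add_one] at this
    nlinarith

theorem tendsto_binomialTail (m : ℕ) {x : ℝ} (h0 : 0 < x) (h1 : x < 1) :
    Filter.Tendsto (fun N => binomialTail m N x) Filter.atTop (nhds 0) := by
  have hs : (0 : ℝ) = ∑ i ∈ Finset.range m, (0 : ℝ) := by simp
  rw [hs]
  refine tendsto_finsetSum _ fun i _ => ?_
  have hx : 0 < 1 - x := by linarith
  have ht := (tendsto_pow_const_mul_const_pow_of_abs_lt_one i
    (r := 1 - x) (by rw [abs_lt]; constructor <;> linarith)).const_mul (((1 - x) ^ i)⁻¹)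
  rw [mul_zero] at ht
  refine squeeze_zero' (Filter.Eventually.of_forall fun N => by positivity) ?_ ht
  filter_upwards [Filter.eventually_ge_atTop i] with N hN
  have e : (1 - x) ^ N = (1 - x) ^ i * (1 - x) ^ (N - i) := by rw [← pow_add]; congr 1; omega
  have e2 : ((1 - x) ^ i)⁻¹ * ((N : ℝ) ^ i * (1 - x) ^ N) = (N : ℝ) ^ i * (1 - x) ^ (N - i) := by
    rw [e]; field_simp
  rw [e2]
  refine mul_le_mul_of_nonneg_right ?_ (by positivity)
  calc (N.choose i : ℝ) * x ^ i ≤ (N.choose i : ℝ) * 1 := by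
        gcongr; exact pow_le_one₀ h0.le h1.le
    _ ≤ (N : ℝ) ^ i := by rw [mul_one]; exact_mod_cast Nat.choose_le_pow N i

/-- Differentiating term by term telescopes: only the negative half of the last summand's derivative
survives. -/
theorem hasDerivAt_binomialTail {k N : ℕ} (h : k + 1 ≤ N) (x : ℝ) :
    HasDerivAt (binomialTail (k + 1) N)
      (-((k + 1) * (N.choose (k + 1) : ℝ) * x ^ k * (1 - x) ^ (N - (k + 1)))) x := by
  have hb : ∀ i j : ℕ, HasDerivAt (fun x : ℝ => x ^ i * (1 - x) ^ j)
      (i * x ^ (i - 1) * (1 - x) ^ j + x ^ i * (j * (1 - x) ^ (j - 1) * (-1))) x := fun i j => by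
    have h1 : HasDerivAt (fun x : ℝ => (1 - x) ^ j) (j * (1 - x) ^ (j - 1) * (-1)) x :=
      ((hasDerivAt_id x).const_sub 1).pow j
    exact (hasDerivAt_pow i x).mul h1
  induction k with
  | zero =>
    have h0 : binomialTail (0 + 1) N = fun x : ℝ => x ^ 0 * (1 - x) ^ N := by
      funext x; simp [binomialTail]
    rw [h0]
    convert hb 0 N using 1
    simp
  | succ k ih =>
    have h0 : binomialTail (k + 1 + 1) N
        = fun x : ℝ => binomialTail (k + 1) N x
          + (N.choose (k + 1) : ℝ) * (x ^ (k + 1) * (1 - x) ^ (N - (k + 1))) := by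
      funext x; simp only [binomialTail, Finset.sum_range_succ]; ring
    rw [h0]
    refine ((ih (by omega)).add ((hb _ _).const_mul _)).congr_deriv ?_
    have e1 : ((N.choose (k + 1 + 1) : ℕ) : ℝ) * (k + 1 + 1)
        = (N.choose (k + 1) : ℝ) * ((N - (k + 1) : ℕ) : ℝ) := by
      exact_mod_cast Nat.choose_succ_right_eq N (k + 1)
    have e2 : N - (k + 1) - 1 = N - (k + 1 + 1) := by omega
    rw [e2]
    simp only [Nat.add_sub_cancel]
    push_cast
    linear_combination x ^ (k + 1) * (1 - x) ^ (N - (k + 1 + 1)) * e1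

theorem integral_binomialTail {k N : ℕ} (h : k + 1 ≤ N) (a : ℝ) :
    ∫ x in a..1, (k + 1) * (N.choose (k + 1) : ℝ) * x ^ k * (1 - x) ^ (N - (k + 1))
      = binomialTail (k + 1) N a := by
  have h1 := intervalIntegral.integral_eq_sub_of_hasDerivAt
    (fun x _ => hasDerivAt_binomialTail h x) (a := a) (b := 1)
    (by apply Continuous.intervalIntegrable; fun_prop)
  rw [binomialTail_one_right h, zero_sub, intervalIntegral.integral_neg, neg_inj] at h1
  exact h1

/-! ### The moment problem identifying the Beta law. -/

/-- A finite measure on `[0,1]` is determined by the moments of `1 - v`. -/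
theorem measure_eq_of_moments {G B : Measure unitInterval} [IsFiniteMeasure G] [IsFiniteMeasure B]
    (h : ∀ k : ℕ, ∫ v, (1 - (v : ℝ)) ^ k ∂G = ∫ v, (1 - (v : ℝ)) ^ k ∂B) : G = B := by
  have hint : ∀ (μ : Measure unitInterval) [IsFiniteMeasure μ] (f : C(unitInterval, ℝ)),
      Integrable f μ := fun μ _ f => (BoundedContinuousFunction.mkOfCompact f).integrable μ
  have hcont : ∀ (μ : Measure unitInterval) [IsFiniteMeasure μ],
      Continuous fun f : C(unitInterval, ℝ) => ∫ v, f v ∂μ := fun μ _ => by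
    refine (LipschitzWith.of_dist_le_mul (K := (μ Set.univ).toNNReal) fun f g => ?_).continuous
    rw [Real.dist_eq, ← integral_sub (hint μ f) (hint μ g), ← Real.norm_eq_abs, mul_comm]
    refine norm_integral_le_of_norm_le_const (Filter.Eventually.of_forall fun v => ?_)
    rw [Real.norm_eq_abs, ← Real.dist_eq]
    exact ContinuousMap.dist_apply_le_dist v
  have hpoly : ∀ (μ : Measure unitInterval) [IsFiniteMeasure μ] (r : Polynomial ℝ),
      ∫ v, r.eval (1 - (v : ℝ)) ∂μ = ∑ i ∈ r.support, r.coeff i * ∫ v, (1 - (v : ℝ)) ^ i ∂μ := by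
    intro μ _ r
    simp only [Polynomial.eval_eq_sum, Polynomial.sum]
    rw [integral_finsetSum]
    · simp only [integral_const_mul]
    · intro i _
      exact hint μ ⟨fun v => r.coeff i * (1 - (v : ℝ)) ^ i, by fun_prop⟩
  -- Weierstrass: two integrals that are continuous in the sup norm and agree on polynomials agree
  -- on all continuous functions.
  have hclosed : IsClosed {f : C(unitInterval, ℝ) | ∫ v, f v ∂G = ∫ v, f v ∂B} :=
    isClosed_eq (hcont G) (hcont B)
  have hsub : (polynomialFunctions unitInterval : Set C(unitInterval, ℝ))
      ⊆ {f : C(unitInterval, ℝ) | ∫ v, f v ∂G = ∫ v, f v ∂B} := by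
    rw [polynomialFunctions_coe]
    rintro _ ⟨r, rfl⟩
    have e : ∀ v : unitInterval, (Polynomial.toContinuousMapOnAlgHom unitInterval r) v
        = (r.comp (1 - Polynomial.X)).eval (1 - (v : ℝ)) := fun v => by simp
    simp only [Set.mem_ofPred_eq, e]
    rw [hpoly, hpoly]
    simp only [h]
  have hall : ∀ f : C(unitInterval, ℝ), ∫ v, f v ∂G = ∫ v, f v ∂B := fun f => by
    have hf : f ∈ (polynomialFunctions unitInterval).topologicalClosure := by
      rw [polynomialFunctions_closure_eq_top']; trivial
    exact closure_minimal hsub hclosed hf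
  exact ext_of_forall_integral_eq_of_IsFiniteMeasure fun f => hall f.toContinuousMap

/-- A law on `[0,1]` whose moments are those of the Beta law with density `(k + 1) v ^ k` has the
binomial tails as partial moments. -/
theorem choose_mul_integral_Ioi_eq_binomialTail {k : ℕ} (G : Measure unitInterval)
    [IsFiniteMeasure G]
    (h : ∀ N, k + 1 ≤ N →
      (N.choose (k + 1) : ℝ) * ∫ v, (1 - (v : ℝ)) ^ (N - (k + 1)) ∂G = 1)
    {N : ℕ} (hN : k + 1 ≤ N) (a : unitInterval) :
    (N.choose (k + 1) : ℝ) * ∫ v in Set.Ioi a, (1 - (v : ℝ)) ^ (N - (k + 1)) ∂G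
      = binomialTail (k + 1) N a := by
  set B : Measure unitInterval :=
    volume.withDensity fun v => ENNReal.ofReal ((k + 1) * (v : ℝ) ^ k) with hB
  have hfin : IsFiniteMeasure B := by
    refine isFiniteMeasure_withDensity_ofReal ?_
    exact ((BoundedContinuousFunction.mkOfCompact
      (⟨fun v : unitInterval => (k + 1) * (v : ℝ) ^ k, by fun_prop⟩ :
        C(unitInterval, ℝ))).integrable volume).2
  have hIB : ∀ (a : unitInterval) (f : ℝ → ℝ), Measurable f → ∫ v in Set.Ioi a, f v ∂B
      = ∫ x in (a : ℝ)..1, (k + 1) * x ^ k * f x := by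
    intro a f hf
    rw [hB, setIntegral_withDensity_eq_setIntegral_toReal_smul (by fun_prop)
      (by simp) _ measurableSet_Ioi]
    rw [intervalIntegral.integral_of_le a.2.2]
    have e1 : ∀ v : unitInterval, (ENNReal.ofReal ((k + 1) * (v : ℝ) ^ k)).toReal • f v
        = (fun x : ℝ => (k + 1) * x ^ k * f x) v := fun v => by
      rw [ENNReal.toReal_ofReal (by have := v.2.1; positivity), smul_eq_mul]
    simp only [e1]
    have e2 : (Set.Ioi a : Set unitInterval) = Subtype.val ⁻¹' (Set.Ioi (a : ℝ)) := by
      ext v; simp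
    rw [e2, unitInterval.measurePreserving_coe.setIntegral_preimage_emb
      (MeasurableEmbedding.subtype_coe measurableSet_Icc) (fun x : ℝ => (k + 1) * x ^ k * f x),
      Measure.restrict_restrict measurableSet_Ioi]
    congr 2
    ext x
    simp only [Set.mem_inter_iff, Set.mem_Ioi, Set.mem_Icc, Set.mem_Ioc]
    exact ⟨fun h => ⟨h.1, h.2.2⟩, fun h => ⟨h.1, a.2.1.trans h.1.le, h.2⟩⟩
  have hT : ∀ {N : ℕ}, k + 1 ≤ N → ∀ a : unitInterval,
      (N.choose (k + 1) : ℝ) * ∫ v in Set.Ioi a, (1 - (v : ℝ)) ^ (N - (k + 1)) ∂B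
        = binomialTail (k + 1) N a := by
    intro N hN a
    rw [hIB a (fun x => (1 - x) ^ (N - (k + 1))) (by fun_prop), ← integral_binomialTail hN,
      ← intervalIntegral.integral_const_mul]
    congr 1
    funext x
    ring
  have h0 : B (Set.Ioi 0)ᶜ = 0 := by
    have : ((Set.Ioi 0)ᶜ : Set unitInterval) = {0} := by
      ext v
      simp only [Set.mem_compl_iff, Set.mem_Ioi, not_lt, Set.mem_singleton_iff]
      exact ⟨fun h => le_antisymm h unitInterval.nonneg', fun h => h.le⟩
    rw [this]
    exact withDensity_absolutelyContinuous _ _ (by simp)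
  have hr : B.restrict (Set.Ioi 0) = B := by
    refine Measure.restrict_eq_self_of_ae_mem ?_
    exact h0
  have hGB : G = B := by
    refine measure_eq_of_moments fun j => ?_
    -- Sample size `j + (k + 1)` isolates the `j`-th moment; for the Beta law it is read off at `a =
    -- 0`, where the tail equals 1.
    have h1 := h (j + (k + 1)) (by omega)
    have h2 := hT (N := j + (k + 1)) (by omega) 0
    rw [hr, Set.Icc.coe_zero, binomialTail_zero_right (by omega)] at h2
    simp only [Nat.add_sub_cancel] at h1 h2
    have hc : (((j + (k + 1)).choose (k + 1) : ℕ) : ℝ) ≠ 0 := by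
      exact_mod_cast (Nat.choose_pos (by omega)).ne'
    exact mul_left_cancel₀ hc (h1.trans h2.symm)
  rw [hGB]
  exact hT hN a

/-! ### The sampling theorem under unique compatible subsamples. -/

section Sampling

variable {Z : Type*} [MeasurableSpace Z] (P : Measure Z) [IsProbabilityMeasure P]

/-- Splitting the coordinates of a sample along an equivalence preserves the product measure. -/
theorem measurePreserving_split {ι κ ν : Type*} [Fintype ι] [Fintype κ] [Fintype ν]
    (e : ι ⊕ κ ≃ ν) :
    MeasurePreserving (fun ω : ν → Z => (fun i => ω (e (Sum.inl i)), fun j => ω (e (Sum.inr j))))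
      (Measure.pi fun _ : ν => P)
      ((Measure.pi fun _ : ι => P).prod (Measure.pi fun _ : κ => P)) := by
  have h1 := (measurePreserving_piCongrLeft (α := fun _ : ν => Z) (fun _ => P) e).symm
  have h2 := measurePreserving_sumPiEquivProdPi (X := fun _ : ι ⊕ κ => Z) (fun _ => P)
  exact h2.comp h1

/-- A measurable set of samples is null if all its sections in one coordinate are. -/
theorem pi_null_of_update_null {ν : Type*} [Fintype ν] [DecidableEq ν] {E : Set (ν → Z)}
    (hE : MeasurableSet E) (j : ν) (h : ∀ ω, P {z | Function.update ω j z ∈ E} = 0) :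
    Measure.pi (fun _ : ν => P) E = 0 := by
  have hf : Measurable (E.indicator (1 : (ν → Z) → ENNReal)) := measurable_one.indicator hE
  have hfg : ∫⋯∫⁻_{j}, (E.indicator (1 : (ν → Z) → ENNReal)) ∂(fun _ : ν => P)
      = ∫⋯∫⁻_{j}, (0 : (ν → Z) → ENNReal) ∂(fun _ : ν => P) := by
    funext ω
    rw [lmarginal_singleton, lmarginal_singleton]
    simp only [Pi.zero_apply, lintegral_zero]
    exact (lintegral_indicator_one ((measurable_update ω) hE)).trans (h ω)
  have := lintegral_eq_of_lmarginal_eq {j} hf measurable_zero hfg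
  rw [lintegral_indicator_one hE] at this
  simpa using this

/-- **Sampling theorem.** Suppose that almost every sample of size `N ≥ k + 1` has exactly one
subsample of size `k + 1` that is compatible with all other sample points. Then the probability
that a compatible subsample has violation probability more than `a` is at most a binomial tail. -/
theorem pi_violation_le_of_existsUnique {k : ℕ} (H : (Fin (k + 1) → Z) → Z → Prop)
    (hH : MeasurableSet {x : (Fin (k + 1) → Z) × Z | H x.1 x.2})
    (hex : ∀ N, k + 1 ≤ N → ∀ᵐ ω ∂Measure.pi (fun _ : Fin N => P),
      ∃! D : {D : Finset (Fin N) // D.card = k + 1},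
        ∀ j ∉ D.1, H (ω ∘ D.1.orderEmbOfFin D.2) (ω j))
    {N : ℕ} (hN : k + 1 ≤ N) (a : unitInterval) :
    Measure.pi (fun _ : Fin N => P) {ω | ∃ D : {D : Finset (Fin N) // D.card = k + 1},
        (∀ j ∉ D.1, H (ω ∘ D.1.orderEmbOfFin D.2) (ω j)) ∧
          ENNReal.ofReal a < P {z | ¬ H (ω ∘ D.1.orderEmbOfFin D.2) z}}
      ≤ ENNReal.ofReal (binomialTail (k + 1) N a) := by
  have hsec : ∀ y, MeasurableSet {z | H y z} := fun y => measurable_prodMk_left hH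
  set V : (Fin (k + 1) → Z) → unitInterval := fun y =>
    ⟨P.real {z | ¬ H y z}, measureReal_nonneg, measureReal_le_one⟩ with hVdef
  have hV : Measurable V := by
    refine Measurable.subtype_mk (Measurable.ennreal_toReal ?_)
    exact measurable_measure_prodMk_left hH.compl
  have hHV : ∀ y, P {z | H y z} = ENNReal.ofReal (1 - (V y : ℝ)) := fun y => by
    have : P.real {z | ¬ H y z} = 1 - P.real {z | H y z} :=
      probReal_compl_eq_one_sub (hsec y)
    rw [hVdef]
    simp only [this, sub_sub_cancel]
    exact (ofReal_measureReal).symm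
  set G : Measure unitInterval := (Measure.pi fun _ : Fin (k + 1) => P).map V with hG
  have hGp : IsProbabilityMeasure G := Measure.isProbabilityMeasure_map hV.aemeasurable
  set A : ∀ N, {D : Finset (Fin N) // D.card = k + 1} → Set unitInterval → Set (Fin N → Z) :=
    fun N D C => {ω | (∀ j ∉ D.1, H (ω ∘ D.1.orderEmbOfFin D.2) (ω j)) ∧
      V (ω ∘ D.1.orderEmbOfFin D.2) ∈ C} with hA
  have hAm : ∀ N D C, MeasurableSet C → MeasurableSet (A N D C) := by
    intro N D C hC
    have hm : Measurable fun ω : Fin N → Z => ω ∘ D.1.orderEmbOfFin D.2 :=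
      measurable_pi_lambda _ fun i => measurable_pi_apply _
    refine MeasurableSet.inter (s₁ := {ω : Fin N → Z | ∀ j ∉ D.1,
      H (ω ∘ D.1.orderEmbOfFin D.2) (ω j)}) ?_ ((hV.comp hm) hC)
    have : {ω : Fin N → Z | ∀ j ∉ D.1, H (ω ∘ D.1.orderEmbOfFin D.2) (ω j)}
        = ⋂ j ∈ (D.1ᶜ : Finset (Fin N)), {ω | H (ω ∘ D.1.orderEmbOfFin D.2) (ω j)} := by
      ext ω; simp
    rw [this]
    refine Finset.measurableSet_biInter _ fun j _ => ?_
    exact (hm.prodMk (measurable_pi_apply j)) hH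
  -- Condition on the subsample indexed by `D`: the remaining points are independent and each is
  -- compatible with probability `1 - V`. The result depends on `D` only through its cardinality.
  have hmass : ∀ N D C, MeasurableSet C → Measure.pi (fun _ : Fin N => P) (A N D C)
      = ENNReal.ofReal (∫ v in C, (1 - (v : ℝ)) ^ (N - (k + 1)) ∂G) := by
    intro N D C hC
    have hc : D.1ᶜ.card = N - (k + 1) := by rw [Finset.card_compl, D.2, Fintype.card_fin]
    have hsp := measurePreserving_split P (finSumEquivOfFinset D.2 hc)
    set T : Set ((Fin (k + 1) → Z) × (Fin (N - (k + 1)) → Z)) :=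
      {x | (∀ j, H x.1 (x.2 j)) ∧ V x.1 ∈ C} with hT
    have hTm : MeasurableSet T := by
      refine MeasurableSet.inter (s₁ := {x : (Fin (k + 1) → Z) × (Fin (N - (k + 1)) → Z) |
        ∀ j, H x.1 (x.2 j)}) ?_ ((hV.comp measurable_fst) hC)
      rw [Set.ofPred_forall]
      refine MeasurableSet.iInter fun j => ?_
      have hm : Measurable fun x : (Fin (k + 1) → Z) × (Fin (N - (k + 1)) → Z) => (x.1, x.2 j) :=
        measurable_fst.prodMk ((measurable_pi_apply j).comp measurable_snd)
      exact hm hH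
    have hAT : A N D C = (fun ω : Fin N → Z =>
        (fun i => ω (finSumEquivOfFinset D.2 hc (Sum.inl i)),
          fun j => ω (finSumEquivOfFinset D.2 hc (Sum.inr j)))) ⁻¹' T := by
      ext ω
      simp only [hA, hT, Set.mem_preimage, Set.mem_ofPred_eq, finSumEquivOfFinset_inl,
        finSumEquivOfFinset_inr]
      refine and_congr ⟨fun h j => ?_, fun h j hj => ?_⟩ Iff.rfl
      · exact h _ (Finset.mem_compl.1 (Finset.orderEmbOfFin_mem _ hc j))
      · have : j ∈ Set.range (D.1ᶜ.orderEmbOfFin hc) := by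
          rw [Finset.range_orderEmbOfFin]; simpa using hj
        obtain ⟨i, rfl⟩ := this
        exact h i
    rw [hAT, hsp.measure_preimage hTm.nullMeasurableSet, Measure.prod_apply hTm]
    have hsl : ∀ y : Fin (k + 1) → Z, Measure.pi (fun _ : Fin (N - (k + 1)) => P)
        (Prod.mk y ⁻¹' T)
        = C.indicator (fun v : unitInterval => ENNReal.ofReal ((1 - (v : ℝ)) ^ (N - (k + 1))))
          (V y) := by
      intro y
      by_cases hy : V y ∈ C
      · have : Prod.mk y ⁻¹' T = Set.univ.pi fun _ : Fin (N - (k + 1)) => {z | H y z} := by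
          ext x; simp [hT, hy]
        rw [this, Measure.pi_pi, Set.indicator_of_mem hy]
        simp only [hHV, Finset.prod_const, Finset.card_univ, Fintype.card_fin]
        rw [ENNReal.ofReal_pow (by linarith [(V y).2.2])]
      · have : Prod.mk y ⁻¹' T = ∅ := by
          ext x; simp [hT, hy]
        rw [this, Set.indicator_of_notMem hy, measure_empty]
    simp only [hsl]
    rw [← lintegral_map (f := C.indicator fun v : unitInterval =>
      ENNReal.ofReal ((1 - (v : ℝ)) ^ (N - (k + 1)))) (by
        refine Measurable.indicator ?_ hC; fun_prop) hV, lintegral_indicator hC,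
      ofReal_integral_eq_lintegral_ofReal]
    · exact ((BoundedContinuousFunction.mkOfCompact
        (⟨fun v : unitInterval => (1 - (v : ℝ)) ^ (N - (k + 1)), by fun_prop⟩ :
          C(unitInterval, ℝ))).integrable _)
    · refine Filter.Eventually.of_forall fun v => ?_
      have : 0 ≤ 1 - (v : ℝ) := by linarith [v.2.2]
      simp only [Pi.zero_apply]
      positivity
  have hcard : ∀ N, Fintype.card {D : Finset (Fin N) // D.card = k + 1} = N.choose (k + 1) :=
    fun N => by simp
  -- Almost surely the compatibility indicators of the subsets `D` sum to 1; take expectations.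
  have hmom : ∀ N, k + 1 ≤ N →
      (N.choose (k + 1) : ℝ) * ∫ v, (1 - (v : ℝ)) ^ (N - (k + 1)) ∂G = 1 := by
    intro N hN
    have h1 : ∫⁻ ω, ∑ D : {D : Finset (Fin N) // D.card = k + 1},
        (A N D Set.univ).indicator (1 : (Fin N → Z) → ENNReal) ω ∂Measure.pi (fun _ : Fin N => P)
        = 1 := by
      have : ∫⁻ _ : Fin N → Z, (1 : ENNReal) ∂Measure.pi (fun _ : Fin N => P) = 1 := by simp
      rw [← this]
      refine lintegral_congr_ae ?_
      filter_upwards [hex N hN] with ω hω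
      obtain ⟨D, hD, hu⟩ := hω
      rw [Finset.sum_eq_single D]
      · rw [Set.indicator_of_mem]
        · rfl
        · exact ⟨hD, trivial⟩
      · intro D' _ hne
        refine Set.indicator_of_notMem (fun h => hne (hu D' h.1)) _
      · simp
    rw [lintegral_finsetSum _ fun D _ => measurable_one.indicator (hAm N D _ MeasurableSet.univ)]
      at h1
    simp only [lintegral_indicator_one (hAm N _ _ MeasurableSet.univ),
      hmass N _ _ MeasurableSet.univ, Finset.sum_const, Finset.card_univ, hcard,
      Measure.restrict_univ, nsmul_eq_mul] at h1
    rw [← ENNReal.toReal_ofReal (r := ∫ v, (1 - (v : ℝ)) ^ (N - (k + 1)) ∂G), ← ENNReal.toReal_natCast,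
      ← ENNReal.toReal_mul, h1, ENNReal.toReal_one]
    refine integral_nonneg fun v => ?_
    have : 0 ≤ 1 - (v : ℝ) := by linarith [v.2.2]
    simp only [Pi.zero_apply]
    positivity
  have hsub : {ω : Fin N → Z | ∃ D : {D : Finset (Fin N) // D.card = k + 1},
        (∀ j ∉ D.1, H (ω ∘ D.1.orderEmbOfFin D.2) (ω j)) ∧
          ENNReal.ofReal a < P {z | ¬ H (ω ∘ D.1.orderEmbOfFin D.2) z}}
      ⊆ ⋃ D, A N D (Set.Ioi a) := by
    rintro ω ⟨D, hD, hlt⟩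
    refine Set.mem_iUnion.2 ⟨D, hD, ?_⟩
    rw [Set.mem_Ioi, ← Subtype.coe_lt_coe]
    exact (ENNReal.ofReal_lt_iff_lt_toReal a.2.1 (measure_ne_top _ _)).1 hlt
  refine (measure_mono hsub).trans ((measure_iUnion_fintype_le _ _).trans ?_)
  simp only [hmass N _ _ measurableSet_Ioi, Finset.sum_const, Finset.card_univ, hcard,
    nsmul_eq_mul]
  rw [← choose_mul_integral_Ioi_eq_binomialTail G hmom hN a,
    ENNReal.ofReal_mul (by positivity), ENNReal.ofReal_natCast]

end Sampling

/-! ### Uniqueness of the padded basis. -/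

section Basis

/-- A finite set has an initial segment of every possible size for an injective labelling. -/
theorem exists_initial_segment {ι : Type*} [DecidableEq ι] {t : ι → ℝ}
    (ht : Function.Injective t) (s : Finset ι) {m : ℕ} (hm : m ≤ s.card) :
    ∃ p ⊆ s, p.card = m ∧ ∀ i ∈ p, ∀ j ∈ s \ p, t i < t j := by
  induction m with
  | zero => exact ⟨∅, by simp, by simp, by simp⟩
  | succ m ih =>
    obtain ⟨p, hps, hpc, hp⟩ := ih (by omega)
    have hne : (s \ p).Nonempty := by
      rw [← Finset.card_pos, Finset.card_sdiff_of_subset hps]; omega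
    obtain ⟨x, hx, hmin⟩ := Finset.exists_min_image (s \ p) t hne
    have hx' := Finset.mem_sdiff.1 hx
    refine ⟨insert x p, Finset.insert_subset hx'.1 hps, ?_, ?_⟩
    · rw [Finset.card_insert_of_notMem hx'.2, hpc]
    · intro i hi j hj
      simp only [Finset.mem_sdiff, Finset.mem_insert, not_or] at hj
      have hj' : j ∈ s \ p := Finset.mem_sdiff.2 ⟨hj.1, hj.2.2⟩
      rcases Finset.mem_insert.1 hi with rfl | hi
      · exact lt_of_le_of_ne (hmin j hj') fun h => hj.2.1 (ht h).symm
      · exact hp i hi j hj'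

/-- In a nondegenerate LP-type problem of combinatorial dimension at most `d`, there is exactly one
set of `d` constraints that determines the value and whose redundant members have the smallest
labels. -/
theorem existsUnique_padded_basis {ι : Type*} [Fintype ι] [DecidableEq ι] {d : ℕ}
    (v : Finset ι → ℝ) (t : ι → ℝ) (hanti : Antitone v)
    (hloc : ∀ S T, (∀ j ∈ T, v (insert j S) = v S) → v (S ∪ T) = v S)
    (hdim : ∃ B : Finset ι, B.card ≤ d ∧ v B = v Finset.univ)
    (hgen : ∀ A B, v A = v Finset.univ → v B = v Finset.univ → v (A ∩ B) = v Finset.univ)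
    (ht : Function.Injective t) (hd : d ≤ Fintype.card ι) :
    ∃! D : {D : Finset ι // D.card = d}, ∀ j ∉ D.1,
      v (insert j D.1) = v D.1 ∧ ∀ i ∈ D.1, v (D.1.erase i) = v D.1 → t i < t j := by
  -- The essential constraints. They lie in every set attaining the full value, and `hgen` shows
  -- that they attain it themselves, one redundant constraint being removed at a time.
  set B₀ : Finset ι := Finset.univ.filter fun i => v (Finset.univ.erase i) ≠ v Finset.univ with hB₀
  have hmem : ∀ i, i ∉ B₀ ↔ v (Finset.univ.erase i) = v Finset.univ := fun i => by simp [hB₀]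
  have huniv : ∀ S, v Finset.univ ≤ v S := fun S => hanti (Finset.subset_univ S)
  have hsub : ∀ T, v T = v Finset.univ → B₀ ⊆ T := by
    intro T hT i hi
    by_contra hiT
    refine (hmem i).not.1 (not_not.2 hi) (le_antisymm ?_ (huniv _))
    rw [← hT]
    exact hanti (Finset.subset_erase.2 ⟨Finset.subset_univ _, hiT⟩)
  have hB₀v : v B₀ = v Finset.univ := by
    have : ∀ X : Finset ι, (∀ i ∈ X, i ∉ B₀) → v (Finset.univ \ X) = v Finset.univ := by
      intro X
      induction X using Finset.induction_on with
      | empty => simp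
      | insert i X _ ih =>
        intro h
        have e : Finset.univ \ insert i X = (Finset.univ \ X) ∩ Finset.univ.erase i := by
          ext j; simp [and_comm]
        rw [e]
        exact hgen _ _ (ih fun j hj => h j (Finset.mem_insert_of_mem hj))
          ((hmem i).1 (h i (Finset.mem_insert_self _ _)))
    have h := this B₀ᶜ (by simp)
    rwa [← Finset.compl_eq_univ_sdiff, compl_compl] at h
  have hsup : ∀ T, B₀ ⊆ T → v T = v Finset.univ := fun T h =>
    le_antisymm (hB₀v ▸ hanti h) (huniv T)
  have hess : ∀ D, v D = v Finset.univ → ∀ i, (v (D.erase i) = v D ↔ i ∉ B₀) := by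
    intro D hD i
    rw [hD]
    refine ⟨fun h => (hmem i).2 (le_antisymm ?_ (huniv _)), fun h => hsup _ ?_⟩
    · rw [← h]; exact hanti (Finset.erase_subset_erase _ (Finset.subset_univ _))
    · exact Finset.subset_erase.2 ⟨hsub D hD, h⟩
  have hcardB : B₀.card ≤ d := by
    obtain ⟨B, hB, hBv⟩ := hdim
    exact (Finset.card_le_card (hsub B hBv)).trans hB
  obtain ⟨p, hps, hpc, hp⟩ := exists_initial_segment ht B₀ᶜ (m := d - B₀.card)
    (by rw [Finset.card_compl]; omega)
  have hdisj : Disjoint B₀ p := Finset.disjoint_left.2 fun i hi hip =>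
    Finset.mem_compl.1 (hps hip) hi
  refine ⟨⟨B₀ ∪ p, by rw [Finset.card_union_of_disjoint hdisj, hpc]; omega⟩, ?_, ?_⟩
  · have hDv : v (B₀ ∪ p) = v Finset.univ := hsup _ Finset.subset_union_left
    intro j hj
    simp only [Finset.mem_union, not_or] at hj
    refine ⟨?_, fun i hi hiv => ?_⟩
    · rw [hDv]
      exact hsup _ (Finset.subset_union_left.trans (Finset.subset_insert _ _))
    · have hi0 := (hess _ hDv i).1 hiv
      exact hp i ((Finset.mem_union.1 hi).resolve_left hi0) j
        (Finset.mem_sdiff.2 ⟨Finset.mem_compl.2 hj.1, hj.2⟩)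
  · rintro ⟨D, hDc⟩ hD
    have hDv : v D = v Finset.univ := by
      have h := hloc D Dᶜ fun j hj => (hD j (Finset.mem_compl.1 hj)).1
      rw [← h, Finset.union_compl]
    have hBD := hsub D hDv
    have hDlt : ∀ i ∈ D, i ∉ B₀ → ∀ j ∉ D, t i < t j := fun i hi hi0 j hj =>
      (hD j hj).2 i hi ((hess D hDv i).2 hi0)
    -- Both `p` and `D \ B₀` are initial segments of `B₀ᶜ` of the same size; a mismatch gives two
    -- elements whose labels would be ordered both ways.
    have hpD : p ⊆ D := by
      by_contra hnot
      obtain ⟨x, hxp, hxD⟩ := Finset.not_subset.1 hnot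
      have hcard : (D \ B₀).card = p.card := by
        rw [Finset.card_sdiff_of_subset hBD, hDc, hpc]
      have : ¬ D \ B₀ ⊆ p := fun h => by
        have := Finset.eq_of_subset_of_card_le h hcard.ge
        exact hxD (Finset.mem_sdiff.1 (this ▸ hxp)).1
      obtain ⟨y, hyD, hyp⟩ := Finset.not_subset.1 this
      obtain ⟨hyD, hy0⟩ := Finset.mem_sdiff.1 hyD
      exact lt_asymm (hp x hxp y (Finset.mem_sdiff.2 ⟨Finset.mem_compl.2 hy0, hyp⟩))
        (hDlt y hyD hy0 x hxD)
    refine Subtype.ext (Finset.eq_of_subset_of_card_le (Finset.union_subset hBD hpD) ?_).symm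
    rw [Finset.card_union_of_disjoint hdisj, hpc, hDc]
    omega

end Basis

/-! ### From LP-type problems to the sampling theorem. -/

section LPType

variable {Z : Type*} [MeasurableSpace Z] [DecidableEq Z] (P : Measure Z) [IsProbabilityMeasure P]

/-- The inserted point becomes coordinate 0 of a sample of size `N + 1`. -/
theorem measurable_insert_image {v : Finset Z → ℝ}
    (hmeas : ∀ (N : ℕ) (S : Finset (Fin N)), Measurable fun ω : Fin N → Z => v (S.image ω))
    {Ω : Type*} [MeasurableSpace Ω] {N : ℕ} (B : Finset (Fin N)) {x : Ω → Z} {y : Ω → Fin N → Z}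
    (hx : Measurable x) (hy : Measurable y) :
    Measurable fun a => v (insert (x a) (B.image (y a))) := by
  have h2 : Measurable fun a => (Fin.cons (x a) (y a) : Fin (N + 1) → Z) := by
    refine measurable_pi_lambda _ fun i => ?_
    refine Fin.cases ?_ (fun i => ?_) i
    · simpa using hx
    · simpa using measurable_pi_iff.1 hy i
  convert (hmeas (N + 1) (insert 0 (B.image Fin.succ))).comp h2 using 1
  funext a
  simp only [Function.comp_def]
  congr 1
  rw [Finset.image_insert, Finset.image_image, Fin.cons_zero]
  congr 1

/-- **Scenario theorem** for random LP-type problems that are almost surely nondegenerate: the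
probability that a further constraint changes the value exceeds `a` with probability at most a
binomial tail. -/
theorem pi_violation_le_of_lpType {k : ℕ} (v : Finset Z → ℝ) (t : Z → ℝ) (ht : Measurable t)
    (hanti : Antitone v)
    (hloc : ∀ S T, (∀ z ∈ T, v (insert z S) = v S) → v (S ∪ T) = v S)
    (hdim : ∀ S, ∃ B ⊆ S, B.card ≤ k + 1 ∧ v B = v S)
    (hmeas : ∀ (N : ℕ) (S : Finset (Fin N)), Measurable fun ω : Fin N → Z => v (S.image ω))
    (hgen : ∀ N, ∀ᵐ ω ∂Measure.pi (fun _ : Fin N => P), ∀ A B : Finset (Fin N),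
      v (A.image ω) = v (Finset.univ.image ω) → v (B.image ω) = v (Finset.univ.image ω) →
        v ((A ∩ B).image ω) = v (Finset.univ.image ω))
    (hinj : ∀ N, ∀ᵐ ω ∂Measure.pi (fun _ : Fin N => P), Function.Injective (t ∘ ω))
    {N : ℕ} (hN : k + 1 ≤ N) (a : unitInterval) :
    Measure.pi (fun _ : Fin N => P) {ω | ENNReal.ofReal a
        < P {z | v (insert z (Finset.univ.image ω)) ≠ v (Finset.univ.image ω)}}
      ≤ ENNReal.ofReal (binomialTail (k + 1) N a) := by
  -- The label clause makes the compatible subsample unique when the basis has fewer than `k + 1`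
  -- members. It only enlarges the violation set, so the bound still controls changes of the value.
  set H : (Fin (k + 1) → Z) → Z → Prop := fun y z =>
    v (insert z (Finset.univ.image y)) = v (Finset.univ.image y) ∧
      ∀ i, v ((Finset.univ.erase i).image y) = v (Finset.univ.image y) → t (y i) < t z with hHdef
  have hH : MeasurableSet {x : (Fin (k + 1) → Z) × Z | H x.1 x.2} := by
    have hI : ∀ S : Finset (Fin (k + 1)),
        Measurable fun x : (Fin (k + 1) → Z) × Z => v (S.image x.1) := fun S =>
      (hmeas (k + 1) S).comp measurable_fst
    have hins : Measurable fun x : (Fin (k + 1) → Z) × Z =>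
        v (insert x.2 (Finset.univ.image x.1)) :=
      measurable_insert_image hmeas _ measurable_snd measurable_fst
    refine MeasurableSet.inter (s₁ := {x : (Fin (k + 1) → Z) × Z |
      v (insert x.2 (Finset.univ.image x.1)) = v (Finset.univ.image x.1)})
      (measurableSet_eq_fun hins (hI _)) ?_
    change MeasurableSet {x : (Fin (k + 1) → Z) × Z | ∀ i, v ((Finset.univ.erase i).image x.1)
      = v (Finset.univ.image x.1) → t (x.1 i) < t x.2}
    have : {x : (Fin (k + 1) → Z) × Z | ∀ i, v ((Finset.univ.erase i).image x.1)
        = v (Finset.univ.image x.1) → t (x.1 i) < t x.2}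
        = ⋂ i, ({x : (Fin (k + 1) → Z) × Z | v ((Finset.univ.erase i).image x.1)
          = v (Finset.univ.image x.1)}ᶜ ∪ {x | t (x.1 i) < t x.2}) := by
      ext x; simp [imp_iff_not_or]
    rw [this]
    refine MeasurableSet.iInter fun i => ?_
    exact (measurableSet_eq_fun (hI _) (hI _)).compl.union (measurableSet_lt
      (ht.comp ((measurable_pi_apply i).comp measurable_fst)) (ht.comp measurable_snd))
  have himage : ∀ {N : ℕ} (ω : Fin N → Z) (D : {D : Finset (Fin N) // D.card = k + 1}),
      Finset.univ.image (ω ∘ D.1.orderEmbOfFin D.2) = D.1.image ω := fun ω D => by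
    rw [← Finset.image_image, Finset.image_orderEmbOfFin_univ]
  have hHD : ∀ {N : ℕ} (ω : Fin N → Z) (D : {D : Finset (Fin N) // D.card = k + 1}) (j : Fin N),
      H (ω ∘ D.1.orderEmbOfFin D.2) (ω j) ↔
        v ((insert j D.1).image ω) = v (D.1.image ω) ∧
          ∀ i ∈ D.1, v ((D.1.erase i).image ω) = v (D.1.image ω) → t (ω i) < t (ω j) := by
    intro N ω D j
    rw [hHdef]
    simp only [himage, Finset.image_insert]
    refine and_congr Iff.rfl ?_
    have he : ∀ i, (Finset.univ.erase i).image (ω ∘ D.1.orderEmbOfFin D.2)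
        = (D.1.erase (D.1.orderEmbOfFin D.2 i)).image ω := fun i => by
      rw [← Finset.image_image, Finset.image_erase (D.1.orderEmbOfFin D.2).injective,
        Finset.image_orderEmbOfFin_univ]
    simp only [he, Function.comp_apply]
    refine ⟨fun h i hi => ?_, fun h i => h _ (Finset.orderEmbOfFin_mem _ _ _)⟩
    have : i ∈ Set.range (D.1.orderEmbOfFin D.2) := by
      rw [Finset.range_orderEmbOfFin]; exact hi
    obtain ⟨i, rfl⟩ := this
    exact h i
  have hex : ∀ N, k + 1 ≤ N → ∀ᵐ ω ∂Measure.pi (fun _ : Fin N => P),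
      ∃! D : {D : Finset (Fin N) // D.card = k + 1},
        ∀ j ∉ D.1, H (ω ∘ D.1.orderEmbOfFin D.2) (ω j) := by
    intro N hN
    filter_upwards [hgen N, hinj N] with ω h1 h2
    simp only [hHD]
    refine existsUnique_padded_basis (fun S => v (S.image ω)) (t ∘ ω)
      (fun S T h => hanti (Finset.image_subset_image h)) (fun S T h => ?_) ?_ h1 h2 (by simpa)
    · simp only [Finset.image_union]
      refine hloc _ _ fun z hz => ?_
      obtain ⟨j, hj, rfl⟩ := Finset.mem_image.1 hz
      simpa [Finset.image_insert] using h j hj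
    · obtain ⟨B, hB, hBc, hBv⟩ := hdim (Finset.univ.image ω)
      obtain ⟨B', -, rfl⟩ := Finset.subset_image_iff.1 hB
      exact ⟨B', by rwa [Finset.card_image_of_injective _ h2.of_comp] at hBc, hBv⟩
  refine le_trans (measure_mono_ae ?_) (pi_violation_le_of_existsUnique P H hH hex hN a)
  filter_upwards [hex N hN] with ω hω hlt
  obtain ⟨D, hD, -⟩ := hω
  refine ⟨D, hD, lt_of_lt_of_le hlt (measure_mono ?_)⟩
  have hDv : v (D.1.image ω) = v (Finset.univ.image ω) := by
    have h := hloc (D.1.image ω) (D.1ᶜ.image ω) fun z hz => by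
      obtain ⟨j, hj, rfl⟩ := Finset.mem_image.1 hz
      simpa [Finset.image_insert] using ((hHD ω D j).1 (hD j (Finset.mem_compl.1 hj))).1
    rw [← h, ← Finset.image_union, Finset.union_compl]
  -- If `z` is compatible with `D`, locality at `D` adds `z` together with the whole sample without
  -- changing the value, so `z` cannot be a violation.
  intro z hz hHz
  refine hz (le_antisymm (hanti (Finset.subset_insert _ _)) ?_)
  have h1 := hHz.1
  rw [himage] at h1
  have h2 := hloc (D.1.image ω) (insert z (Finset.univ.image ω)) fun x hx => by
    rcases Finset.mem_insert.1 hx with rfl | hx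
    · exact h1
    · refine le_antisymm (hanti (Finset.subset_insert _ _)) ?_
      rw [hDv]
      exact hanti (Finset.insert_subset hx (Finset.image_subset_image (Finset.subset_univ _)))
  rw [← hDv, ← h2]
  exact hanti Finset.subset_union_right

end LPType

/-! ### Strictly concave max-min problems as LP-type problems. -/

section MaxMin

variable {Z E : Type*}

/-- The pointwise minimum of `g₀` and of the functions `g z`, `z ∈ S`. -/
noncomputable def pointwiseMin (g₀ : E → ℝ) (g : Z → E → ℝ) (S : Finset Z) (x : E) : ℝ :=
  S.fold min (g₀ x) fun z => g z x

/-- The maximum over `C` of the pointwise minimum of `g₀` and of the functions `g z`, `z ∈ S`. -/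
noncomputable def maxMin (C : Set E) (g₀ : E → ℝ) (g : Z → E → ℝ) (S : Finset Z) : ℝ :=
  sSup (pointwiseMin g₀ g S '' C)

variable {C : Set E} {g₀ : E → ℝ} {g : Z → E → ℝ}

theorem le_pointwiseMin {S : Finset Z} {x : E} {r : ℝ} :
    r ≤ pointwiseMin g₀ g S x ↔ r ≤ g₀ x ∧ ∀ z ∈ S, r ≤ g z x :=
  Finset.le_fold_min r

theorem lt_pointwiseMin {S : Finset Z} {x : E} {r : ℝ} :
    r < pointwiseMin g₀ g S x ↔ r < g₀ x ∧ ∀ z ∈ S, r < g z x :=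
  Finset.lt_fold_min r

theorem pointwiseMin_anti {S T : Finset Z} (h : S ⊆ T) (x : E) :
    pointwiseMin g₀ g T x ≤ pointwiseMin g₀ g S x := by
  have := (le_pointwiseMin (g₀ := g₀) (g := g) (S := T) (x := x)).1 le_rfl
  exact le_pointwiseMin.2 ⟨this.1, fun z hz => this.2 z (h hz)⟩

theorem continuous_pointwiseMin [TopologicalSpace E] (h₀ : Continuous g₀)
    (hg : ∀ z, Continuous (g z)) (S : Finset Z) : Continuous (pointwiseMin g₀ g S) := by
  classical
  induction S using Finset.induction_on with
  | empty => exact h₀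
  | insert z S hz ih =>
    have : pointwiseMin g₀ g (insert z S) = fun x => min (g z x) (pointwiseMin g₀ g S x) := by
      funext x; exact Finset.fold_insert hz
    rw [this]
    exact (hg z).min ih

section

variable [TopologicalSpace E] (hC : IsCompact C) (hne : C.Nonempty) (h₀ : Continuous g₀)
  (hg : ∀ z, Continuous (g z))
include hC hne h₀ hg

theorem exists_maxMin (S : Finset Z) :
    ∃ x ∈ C, pointwiseMin g₀ g S x = maxMin C g₀ g S ∧
      ∀ y ∈ C, pointwiseMin g₀ g S y ≤ maxMin C g₀ g S := by
  obtain ⟨x, hx, hmax⟩ := hC.exists_isMaxOn hne (continuous_pointwiseMin h₀ hg S).continuousOn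
  have : IsGreatest (pointwiseMin g₀ g S '' C) (pointwiseMin g₀ g S x) :=
    ⟨⟨x, hx, rfl⟩, by rintro _ ⟨y, hy, rfl⟩; exact hmax hy⟩
  have e := this.csSup_eq
  exact ⟨x, hx, e.symm, fun y hy => by rw [maxMin, e]; exact hmax hy⟩

theorem pointwiseMin_le_maxMin (S : Finset Z) {x : E} (hx : x ∈ C) :
    pointwiseMin g₀ g S x ≤ maxMin C g₀ g S := by
  obtain ⟨_, -, -, h⟩ := exists_maxMin hC hne h₀ hg S
  exact h x hx

theorem maxMin_antitone : Antitone (maxMin C g₀ g) := by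
  intro S T h
  obtain ⟨x, hx, hxT, -⟩ := exists_maxMin hC hne h₀ hg T
  rw [← hxT]
  exact (pointwiseMin_anti h x).trans (pointwiseMin_le_maxMin hC hne h₀ hg S hx)

theorem lt_maxMin_iff (S : Finset Z) {r : ℝ} :
    r < maxMin C g₀ g S ↔ ∃ x ∈ C, r < pointwiseMin g₀ g S x := by
  constructor
  · intro h
    obtain ⟨x, hx, hxS, -⟩ := exists_maxMin hC hne h₀ hg S
    exact ⟨x, hx, hxS ▸ h⟩
  · rintro ⟨x, hx, h⟩
    exact h.trans_le (pointwiseMin_le_maxMin hC hne h₀ hg S hx)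

/-- A strict superlevel set is a union, over points of `C`, of finite intersections of open
conditions on the sample, hence open even though the union is uncountable. -/
theorem measurable_maxMin_image [DecidableEq Z] [TopologicalSpace Z] [SecondCountableTopology Z]
    [MeasurableSpace Z] [BorelSpace Z] (hgz : ∀ x, Continuous fun z => g z x) (N : ℕ)
    (S : Finset (Fin N)) : Measurable fun ω : Fin N → Z => maxMin C g₀ g (S.image ω) := by
  refine measurable_of_Ioi fun r => IsOpen.measurableSet ?_
  have : (fun ω : Fin N → Z => maxMin C g₀ g (S.image ω)) ⁻¹' Set.Ioi r
      = ⋃ x ∈ C, {ω : Fin N → Z | r < g₀ x ∧ ∀ i ∈ S, r < g (ω i) x} := by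
    ext ω
    simp [lt_maxMin_iff hC hne h₀ hg, lt_pointwiseMin, and_left_comm]
  rw [this]
  refine isOpen_biUnion fun x _ => ?_
  refine isOpen_const.inter (t := {ω : Fin N → Z | ∀ i ∈ S, r < g (ω i) x}) ?_
  have : {ω : Fin N → Z | ∀ i ∈ S, r < g (ω i) x}
      = ⋂ i ∈ S, {ω : Fin N → Z | r < g (ω i) x} := by
    ext ω; simp
  rw [this]
  exact isOpen_biInter_finset fun i _ =>
    isOpen_lt continuous_const ((hgz x).comp (continuous_apply i))

end

variable [NormedAddCommGroup E] [NormedSpace ℝ E] (hC : IsCompact C) (hconv : Convex ℝ C)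
  (hne : C.Nonempty) (h₀ : Continuous g₀) (hg : ∀ z, Continuous (g z))
  (s₀ : StrictConcaveOn ℝ Set.univ g₀) (sg : ∀ z, StrictConcaveOn ℝ Set.univ (g z))

include hC hconv hne h₀ hg s₀ sg in
-- At the midpoint of two distinct maximizers every function in the finite minimum would strictly
-- exceed the maximum.
theorem maximizer_unique {S : Finset Z} {x y : E} (hx : x ∈ C) (hy : y ∈ C)
    (hxS : maxMin C g₀ g S ≤ pointwiseMin g₀ g S x)
    (hyS : maxMin C g₀ g S ≤ pointwiseMin g₀ g S y) : x = y := by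
  by_contra hxy
  have key : ∀ f : E → ℝ, StrictConcaveOn ℝ Set.univ f → maxMin C g₀ g S ≤ f x →
      maxMin C g₀ g S ≤ f y → maxMin C g₀ g S < f ((1 / 2 : ℝ) • x + (1 / 2 : ℝ) • y) := by
    intro f hf h1 h2
    have := hf.2 (Set.mem_univ x) (Set.mem_univ y) hxy
      (by norm_num : (0 : ℝ) < 1 / 2) (by norm_num : (0 : ℝ) < 1 / 2) (by norm_num)
    simp only [smul_eq_mul] at this
    linarith
  rw [le_pointwiseMin] at hxS hyS
  have hmid : (1 / 2 : ℝ) • x + (1 / 2 : ℝ) • y ∈ C :=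
    hconv hx hy (by norm_num) (by norm_num) (by norm_num)
  refine lt_irrefl _ (((lt_pointwiseMin (S := S)).2 ⟨key g₀ s₀ hxS.1 hyS.1, fun z hz => ?_⟩).trans_le
    (pointwiseMin_le_maxMin hC hne h₀ hg S hmid))
  exact key _ (sg z) (hxS.2 z hz) (hyS.2 z hz)

include hC hconv hne h₀ hg s₀ sg in
theorem maximizer_of_maxMin_eq {S T : Finset Z} (hST : S ⊆ T)
    (hv : maxMin C g₀ g T = maxMin C g₀ g S) {x : E} (hx : x ∈ C)
    (hxS : pointwiseMin g₀ g S x = maxMin C g₀ g S) :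
    pointwiseMin g₀ g T x = maxMin C g₀ g S := by
  obtain ⟨y, hy, hyT, -⟩ := exists_maxMin hC hne h₀ hg T
  have : x = y := maximizer_unique hC hconv hne h₀ hg s₀ sg (S := S) hx hy hxS.ge (by
    rw [← hv, ← hyT]; exact pointwiseMin_anti hST y)
  rw [this, hyT, hv]

include hC hconv hne h₀ hg s₀ sg in
-- By uniqueness the old maximizer is the only candidate for keeping the value, so redundancy is
-- tested at this single point. Locality and monotonicity in the label both follow from this.
theorem maxMin_insert_eq_iff [DecidableEq Z] {S : Finset Z} {x : E} (hx : x ∈ C)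
    (hxS : pointwiseMin g₀ g S x = maxMin C g₀ g S) (z : Z) :
    maxMin C g₀ g (insert z S) = maxMin C g₀ g S ↔ maxMin C g₀ g S ≤ g z x := by
  constructor
  · intro h
    have := maximizer_of_maxMin_eq hC hconv hne h₀ hg s₀ sg (Finset.subset_insert z S) h hx hxS
    exact (le_pointwiseMin.1 this.ge).2 z (Finset.mem_insert_self z S)
  · intro h
    refine le_antisymm (maxMin_antitone hC hne h₀ hg (Finset.subset_insert z S)) ?_
    refine le_trans ?_ (pointwiseMin_le_maxMin hC hne h₀ hg _ hx)
    have h1 := le_pointwiseMin.1 hxS.ge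
    refine le_pointwiseMin.2 ⟨h1.1, fun w hw => ?_⟩
    rcases Finset.mem_insert.1 hw with rfl | hw
    · exact h
    · exact h1.2 w hw

include hC hconv hne h₀ hg s₀ sg in
theorem maxMin_union_eq [DecidableEq Z] (S T : Finset Z)
    (h : ∀ z ∈ T, maxMin C g₀ g (insert z S) = maxMin C g₀ g S) :
    maxMin C g₀ g (S ∪ T) = maxMin C g₀ g S := by
  obtain ⟨x, hx, hxS, -⟩ := exists_maxMin hC hne h₀ hg S
  refine le_antisymm (maxMin_antitone hC hne h₀ hg Finset.subset_union_left) ?_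
  refine le_trans ?_ (pointwiseMin_le_maxMin hC hne h₀ hg _ hx)
  have h1 := le_pointwiseMin.1 hxS.ge
  refine le_pointwiseMin.2 ⟨h1.1, fun w hw => ?_⟩
  rcases Finset.mem_union.1 hw with hw | hw
  · exact h1.2 w hw
  · exact (maxMin_insert_eq_iff hC hconv hne h₀ hg s₀ sg hx hxS w).1 (h w hw)

include hC hconv hne h₀ hg s₀ sg in
-- Choose `B` with the least value `r` among subsets of size at most `finrank + 1`. Every such
-- subset then has a point at level `r`, and Helly's theorem supplies one for all of `S`. The
-- conditions `x ∈ C` and `r ≤ g₀ x` are built into each convex set, so they do not count towards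
-- the dimension.
theorem exists_basis_maxMin [FiniteDimensional ℝ E] (S : Finset Z) :
    ∃ B ⊆ S, B.card ≤ Module.finrank ℝ E + 1 ∧ maxMin C g₀ g B = maxMin C g₀ g S := by
  classical
  obtain ⟨B, hB, hmin⟩ := Finset.exists_min_image
    (S.powerset.filter fun B => B.card ≤ Module.finrank ℝ E + 1) (maxMin C g₀ g) ⟨∅, by simp⟩
  simp only [Finset.mem_filter, Finset.mem_powerset] at hB hmin
  refine ⟨B, hB.1, hB.2, le_antisymm ?_ (maxMin_antitone hC hne h₀ hg hB.1)⟩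
  rcases S.eq_empty_or_nonempty with rfl | ⟨z₀, hz₀⟩
  · rw [Finset.subset_empty.1 hB.1]
  set r := maxMin C g₀ g B
  have hH : (⋂ z ∈ S, {x | x ∈ C ∧ r ≤ g₀ x ∧ r ≤ g z x}).Nonempty := by
    refine Convex.helly_theorem' (𝕜 := ℝ) (fun z _ => ?_) fun I hI hIc => ?_
    · refine hconv.inter (t := {x | r ≤ g₀ x ∧ r ≤ g z x}) ?_
      have h1 := s₀.concaveOn.convex_ge r
      have h2 := (sg z).concaveOn.convex_ge r
      simp only [Set.mem_univ, true_and] at h1 h2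
      exact h1.inter h2
    · obtain ⟨x, hx, hxI, -⟩ := exists_maxMin hC hne h₀ hg I
      have hr := hmin I ⟨hI, hIc⟩
      rw [← hxI, le_pointwiseMin] at hr
      exact ⟨x, Set.mem_iInter₂.2 fun z hz => ⟨hx, hr.1, hr.2 z hz⟩⟩
  obtain ⟨x, hx⟩ := hH
  rw [Set.mem_iInter₂] at hx
  refine le_trans ?_ (pointwiseMin_le_maxMin hC hne h₀ hg S (hx z₀ hz₀).1)
  exact le_pointwiseMin.2 ⟨(hx z₀ hz₀).2.1, fun z hz => (hx z hz).2.2⟩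

include hC hconv hne h₀ hg s₀ sg in
/-- Constraints that are slack at the maximizer may be dropped. -/
theorem maxMin_inter_eq [DecidableEq Z] {S A B : Finset Z} (hA : A ⊆ S) (hB : B ⊆ S)
    (hAv : maxMin C g₀ g A = maxMin C g₀ g S) (hBv : maxMin C g₀ g B = maxMin C g₀ g S)
    (hslack : ∀ z ∈ A, z ∉ B → maxMin C g₀ g (insert z B) = maxMin C g₀ g B →
      ∀ x ∈ C, pointwiseMin g₀ g B x = maxMin C g₀ g B → maxMin C g₀ g B < g z x) :
    maxMin C g₀ g (A ∩ B) = maxMin C g₀ g S := by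
  have hanti := maxMin_antitone hC hne h₀ hg
  refine le_antisymm ?_ (hanti (Finset.inter_subset_left.trans hA))
  by_contra! hlt
  obtain ⟨x, hx, hxB, -⟩ := exists_maxMin hC hne h₀ hg B
  obtain ⟨y, hy, hyI, -⟩ := exists_maxMin hC hne h₀ hg (A ∩ B)
  set r := maxMin C g₀ g S
  have hxS : pointwiseMin g₀ g S x = r := by
    rw [maximizer_of_maxMin_eq hC hconv hne h₀ hg s₀ sg hB hBv.symm hx hxB, hBv]
  have hxS' := le_pointwiseMin.1 hxS.ge
  have hyI' := lt_pointwiseMin.1 (hyI.symm ▸ hlt : r < pointwiseMin g₀ g (A ∩ B) y)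
  have hsl : ∀ z ∈ A, z ∉ B → r < g z x := by
    intro z hz hzB
    have := hslack z hz hzB (le_antisymm (hanti (Finset.subset_insert _ _))
      (hBv ▸ hanti (Finset.insert_subset (hA hz) hB))) x hx hxB
    rwa [hBv] at this
  -- Move slightly from the maximizer `x` towards `y`, which beats `r` on `A ∩ B`. By concavity the
  -- constraints in `A ∩ B` become strictly better than `r`, while those in `A \ B` are slack at `x`
  -- and stay above `r`; so `A` would have value above `r`.
  set c : ℝ → E := fun l => (1 - l) • x + l • y with hc
  have hc0 : c 0 = x := by simp [hc]
  have hcc : Continuous c := by fun_prop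
  have hev : ∀ᶠ l in nhdsWithin (0 : ℝ) (Set.Ioi 0), ∀ z ∈ A \ B, r < g z (c l) := by
    rw [Filter.eventually_all_finset]
    intro z hz
    obtain ⟨hz, hzB⟩ := Finset.mem_sdiff.1 hz
    have : Filter.Tendsto (fun l => g z (c l)) (nhds 0) (nhds (g z x)) := by
      have h := ((hg z).comp hcc).tendsto 0
      simpa only [Function.comp_def, hc0] using h
    exact (this.eventually (lt_mem_nhds (hsl z hz hzB))).filter_mono nhdsWithin_le_nhds
  have hev2 : ∀ᶠ l in nhdsWithin (0 : ℝ) (Set.Ioi 0), l ∈ Set.Ioo (0 : ℝ) 1 :=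
    Ioo_mem_nhdsGT one_pos
  obtain ⟨l, hl, hl0, hl1⟩ := (hev.and hev2).exists
  have key : ∀ f : E → ℝ, StrictConcaveOn ℝ Set.univ f → r ≤ f x → r < f y → r < f (c l) := by
    intro f hf h1 h2
    have := hf.concaveOn.2 (Set.mem_univ x) (Set.mem_univ y) (sub_nonneg.2 hl1.le) hl0.le
      (by ring)
    simp only [smul_eq_mul] at this
    refine lt_of_lt_of_le ?_ this
    nlinarith
  have hcl : c l ∈ C := hconv hx hy (sub_nonneg.2 hl1.le) hl0.le (by ring)
  refine lt_irrefl r (lt_of_lt_of_le ?_ ((pointwiseMin_le_maxMin hC hne h₀ hg A hcl).trans hAv.le))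
  refine lt_pointwiseMin.2 ⟨key g₀ s₀ hxS'.1 hyI'.1, fun z hz => ?_⟩
  by_cases hzB : z ∈ B
  · exact key _ (sg z) (hxS'.2 z (hA hz)) (hyI'.2 z (Finset.mem_inter.2 ⟨hz, hzB⟩))
  · exact hl z (Finset.mem_sdiff.2 ⟨hz, hzB⟩)

end MaxMin

/-! ### Almost sure nondegeneracy through uniform labels. -/

section Labelled

variable {K E : Type*} [MeasurableSpace K] (μ : Measure K) [IsProbabilityMeasure μ]

/-- Almost surely, independent uniform labels are distinct. -/
theorem ae_injective_label (N : ℕ) :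
    ∀ᵐ ω ∂Measure.pi (fun _ : Fin N => μ.prod (volume : Measure unitInterval)),
      Function.Injective ((fun z : K × unitInterval => (z.2 : ℝ)) ∘ ω) := by
  have h : ∀ i j : Fin N, i ≠ j →
      ∀ᵐ ω ∂Measure.pi (fun _ : Fin N => μ.prod (volume : Measure unitInterval)),
        (ω i).2 ≠ (ω j).2 := by
    intro i j hij
    have hm : MeasurableSet {ω : Fin N → K × unitInterval | (ω i).2 = (ω j).2} :=
      measurableSet_eq_fun (measurable_snd.comp (measurable_pi_apply i))
        (measurable_snd.comp (measurable_pi_apply j))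
    have h0 := pi_null_of_update_null (μ.prod (volume : Measure unitInterval)) hm j fun ω => by
      have : {z : K × unitInterval | Function.update ω j z ∈
          {ω : Fin N → K × unitInterval | (ω i).2 = (ω j).2}} = Set.univ ×ˢ {(ω i).2} := by
        ext z
        simp [Function.update_of_ne hij, eq_comm]
      rw [this, Measure.prod_prod]
      simp
    rw [ae_iff]
    simpa using h0
  have h' : ∀ᵐ ω ∂Measure.pi (fun _ : Fin N => μ.prod (volume : Measure unitInterval)),
      ∀ i j : Fin N, i ≠ j → (ω i).2 ≠ (ω j).2 := by
    rw [ae_all_iff]; intro i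
    rw [ae_all_iff]; intro j
    by_cases hij : i = j
    · simp [hij]
    · filter_upwards [h i j hij] with ω hω _ using hω
  filter_upwards [h'] with ω hω i j hij
  by_contra hne
  exact hω i j hne (Subtype.ext hij)

variable [TopologicalSpace K] [SecondCountableTopology K] [BorelSpace K]
  [NormedAddCommGroup E] [NormedSpace ℝ E] [FiniteDimensional ℝ E]
  {C : Set E} {g₀ : E → ℝ} {g : K × unitInterval → E → ℝ}
  (hC : IsCompact C) (hconv : Convex ℝ C) (hne : C.Nonempty)
  (h₀ : Continuous g₀) (hg : ∀ z, Continuous (g z))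
  (s₀ : StrictConcaveOn ℝ Set.univ g₀) (sg : ∀ z, StrictConcaveOn ℝ Set.univ (g z))
  (hgz : ∀ x, Continuous fun z => g z x) (hmono : ∀ k x, StrictMono fun s => g (k, s) x)

omit [FiniteDimensional ℝ E] in
include hC hconv hne h₀ hg s₀ sg hgz hmono in
/-- Almost surely, a constraint that does not change the value of the other ones is slack. -/
theorem ae_slack [DecidableEq (K × unitInterval)] {N : ℕ} (B : Finset (Fin N)) {j : Fin N}
    (hj : j ∉ B) :
    ∀ᵐ ω ∂Measure.pi (fun _ : Fin N => μ.prod (volume : Measure unitInterval)),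
      maxMin C g₀ g (insert (ω j) (B.image ω)) = maxMin C g₀ g (B.image ω) →
      ∀ x ∈ C, pointwiseMin g₀ g (B.image ω) x = maxMin C g₀ g (B.image ω) →
        maxMin C g₀ g (B.image ω) < g (ω j) x := by
  set v := maxMin C g₀ g with hv
  have hmeas := measurable_maxMin_image (Z := K × unitInterval) hC hne h₀ hg hgz
  set D := TopologicalSpace.denseSeq unitInterval
  -- Here the `j`-th constraint is redundant but no smaller label from a dense sequence keeps it so.
  -- Countability gives measurability. Redundancy is monotone in the label, so with everything else
  -- fixed at most one label lies in `X`.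
  set X : Set (Fin N → K × unitInterval) :=
    {ω | v (insert (ω j) (B.image ω)) = v (B.image ω)} ∩
      ⋂ m : ℕ, ({ω | D m < (ω j).2}ᶜ ∪
        {ω | v (insert ((ω j).1, D m) (B.image ω)) = v (B.image ω)}ᶜ) with hX
  have hXm : MeasurableSet X := by
    refine MeasurableSet.inter (measurableSet_eq_fun
      (measurable_insert_image hmeas B (measurable_pi_apply j) measurable_id) (hmeas N B)) ?_
    refine MeasurableSet.iInter fun m => MeasurableSet.union ?_ ?_
    · exact (measurableSet_lt measurable_const
        (measurable_snd.comp (measurable_pi_apply j))).compl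
    · exact (measurableSet_eq_fun (measurable_insert_image hmeas B
        ((measurable_fst.comp (measurable_pi_apply j)).prodMk measurable_const) measurable_id)
        (hmeas N B)).compl
  have hmon : ∀ S k, ∀ s s' : unitInterval, s ≤ s' → v (insert (k, s) S) = v S →
      v (insert (k, s') S) = v S := by
    intro S k s s' hs h
    obtain ⟨x, hx, hxS, -⟩ := exists_maxMin hC hne h₀ hg S
    rw [hv, maxMin_insert_eq_iff hC hconv hne h₀ hg s₀ sg hx hxS] at h ⊢
    exact h.trans ((hmono k x).monotone hs)
  have h0 : Measure.pi (fun _ : Fin N => μ.prod (volume : Measure unitInterval)) X = 0 := by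
    refine pi_null_of_update_null _ hXm j fun ω => ?_
    refine (Measure.measure_prod_null (measurable_update ω hXm)).2 ?_
    refine Filter.Eventually.of_forall fun k => ?_
    refine Set.Subsingleton.measure_zero ?_ _
    have himg : ∀ z, B.image (Function.update ω j z) = B.image ω := fun z =>
      Finset.image_congr fun i hi => Function.update_of_ne (by rintro rfl; exact hj hi) _ _
    have key : ∀ s s' : unitInterval, Function.update ω j (k, s) ∈ X →
        Function.update ω j (k, s') ∈ X → ¬ s < s' := by
      intro s s' h1 h2 hlt
      obtain ⟨c, ⟨m, rfl⟩, h3, h4⟩ :=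
        (TopologicalSpace.denseRange_denseSeq unitInterval).exists_between hlt
      have h1' := h1.1
      have h2' := Set.mem_iInter.1 h2.2 m
      simp only [Set.mem_ofPred_eq, Function.update_self, himg, Set.mem_union,
        Set.mem_compl_iff] at h1' h2'
      exact h2'.elim (fun h => h h4) fun h => h (hmon _ _ _ _ h3.le h1')
    intro s hs s' hs'
    exact le_antisymm (not_lt.1 (key _ _ hs' hs)) (not_lt.1 (key _ _ hs hs'))
  filter_upwards [measure_eq_zero_iff_ae_notMem.1 h0] with ω hω heq x hx hxB
  -- A strictly smaller label that is still redundant yields slackness, since the constraint is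
  -- strictly increasing in its label.
  have : ∃ m, D m < (ω j).2 ∧ v (insert ((ω j).1, D m) (B.image ω)) = v (B.image ω) := by
    by_contra! hcon
    refine hω ⟨heq, Set.mem_iInter.2 fun m => ?_⟩
    by_cases hm : D m < (ω j).2
    · exact Or.inr (hcon m hm)
    · exact Or.inl hm
  obtain ⟨m, hm, hmv⟩ := this
  rw [hv, maxMin_insert_eq_iff hC hconv hne h₀ hg s₀ sg hx hxB] at hmv
  exact hmv.trans_lt (hmono (ω j).1 x hm)

include hC hconv hne h₀ hg s₀ sg hgz hmono in
/-- The scenario theorem for concave max-min problems with uniformly perturbed constraints. -/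
theorem pi_violation_maxMin_le [DecidableEq (K × unitInterval)] {N : ℕ}
    (hN : Module.finrank ℝ E + 1 ≤ N) (a : unitInterval) :
    Measure.pi (fun _ : Fin N => μ.prod (volume : Measure unitInterval)) {ω | ENNReal.ofReal a
        < μ.prod (volume : Measure unitInterval) {z |
          maxMin C g₀ g (insert z (Finset.univ.image ω))
            ≠ maxMin C g₀ g (Finset.univ.image ω)}}
      ≤ ENNReal.ofReal (binomialTail (Module.finrank ℝ E + 1) N a) := by
  refine pi_violation_le_of_lpType (μ.prod (volume : Measure unitInterval)) (maxMin C g₀ g)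
    (fun z => (z.2 : ℝ)) (by fun_prop) (maxMin_antitone hC hne h₀ hg)
    (maxMin_union_eq hC hconv hne h₀ hg s₀ sg) (exists_basis_maxMin hC hconv hne h₀ hg s₀ sg)
    (measurable_maxMin_image hC hne h₀ hg hgz) (fun N => ?_) (ae_injective_label μ) hN a
  have hall : ∀ᵐ ω ∂Measure.pi (fun _ : Fin N => μ.prod (volume : Measure unitInterval)),
      ∀ (B : Finset (Fin N)) (j : Fin N), j ∉ B →
      maxMin C g₀ g (insert (ω j) (B.image ω)) = maxMin C g₀ g (B.image ω) →
      ∀ x ∈ C, pointwiseMin g₀ g (B.image ω) x = maxMin C g₀ g (B.image ω) →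
        maxMin C g₀ g (B.image ω) < g (ω j) x := by
    rw [ae_all_iff]; intro B
    rw [ae_all_iff]; intro j
    by_cases hj : j ∈ B
    · simp [hj]
    · filter_upwards [ae_slack μ hC hconv hne h₀ hg s₀ sg hgz hmono B hj] with ω hω _ using hω
  filter_upwards [hall, ae_injective_label μ N] with ω hω hinj A B hA hB
  rw [Finset.image_inter _ _ hinj.of_comp]
  refine maxMin_inter_eq hC hconv hne h₀ hg s₀ sg
    (Finset.image_subset_image (Finset.subset_univ A))
    (Finset.image_subset_image (Finset.subset_univ B)) hA hB fun z hz hzB => ?_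
  obtain ⟨j, hj, rfl⟩ := Finset.mem_image.1 hz
  exact hω B j fun h => hzB (Finset.mem_image_of_mem ω h)

end Labelled

/-! ### Lipschitz norms, ball volumes, the regularizing ball and the sample size. -/

namespace MDP

section Lipschitz

variable {X : Type*} [PseudoMetricSpace X] [CompactSpace X] {f : X → ℝ}

theorem abs_le_lipNorm (hf : Continuous f) (x : X) : |f x| ≤ lipNorm f := by
  have : BddAbove (Set.range fun x => |f x|) := (isCompact_range hf.abs).bddAbove
  exact (le_ciSup this x).trans (le_max_left _ _)

omit [CompactSpace X] in
theorem abs_sub_le_lipNorm {c : NNReal} (hf : LipschitzWith c f) (x y : X) :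
    |f x - f y| ≤ lipNorm f * dist x y := by
  have hb : BddAbove (Set.range fun z : X × X => |f z.1 - f z.2| / dist z.1 z.2) := by
    refine ⟨c, ?_⟩
    rintro _ ⟨z, rfl⟩
    refine div_le_of_le_mul₀ dist_nonneg c.2 ?_
    have := hf.dist_le_mul z.1 z.2
    rwa [Real.dist_eq] at this
  have h1 : |f x - f y| / dist x y ≤ lipNorm f :=
    (le_ciSup hb (x, y)).trans (le_max_right _ _)
  rcases eq_or_lt_of_le (dist_nonneg (x := x) (y := y)) with h | h
  · have := hf.dist_le_mul x y
    rw [← h, mul_zero, Real.dist_eq] at this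
    rwa [← h, mul_zero]
  · exact (div_le_iff₀ h).1 h1

omit [CompactSpace X] in
theorem lipNorm_nonneg (f : X → ℝ) : 0 ≤ lipNorm f :=
  le_max_of_le_left (Real.iSup_nonneg fun _ => abs_nonneg _)

end Lipschitz

section Ball

/-- The ball contains a one-sided interval of length `r` where one fits, and otherwise all of
`(0,1)`. There is no factor 2 because the centre may be an endpoint. -/
theorem le_volume_ball_unitInterval (x : unitInterval) {r : ℝ} (h1 : r ≤ 1) :
    ENNReal.ofReal r ≤ volume (Metric.ball x r) := by
  rcases le_total r 0 with h0 | h0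
  · simp [ENNReal.ofReal_of_nonpos h0]
  rcases le_total ((x : ℝ) + r) 1 with h | h
  · have : Set.Ico x ⟨x + r, by linarith [x.2.1], h⟩ ⊆ Metric.ball x r := fun y hy => by
      have h2 : (x : ℝ) ≤ y := hy.1
      have h3 : (y : ℝ) < x + r := hy.2
      rw [Metric.mem_ball, Subtype.dist_eq, Real.dist_eq, abs_lt]
      constructor <;> linarith
    refine le_trans (le_of_eq ?_) (measure_mono this)
    rw [unitInterval.volume_Ico]
    congr 1
    simp
  rcases le_total r (x : ℝ) with h' | h'
  · have : Set.Ioc ⟨x - r, by linarith, by linarith [x.2.2]⟩ x ⊆ Metric.ball x r := fun y hy => by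
      have h2 : (x : ℝ) - r < y := hy.1
      have h3 : (y : ℝ) ≤ x := hy.2
      rw [Metric.mem_ball, Subtype.dist_eq, Real.dist_eq, abs_lt]
      constructor <;> linarith
    refine le_trans (le_of_eq ?_) (measure_mono this)
    rw [unitInterval.volume_Ioc]
    congr 1
    simp
  · have : Set.Ioo (0 : unitInterval) 1 ⊆ Metric.ball x r := fun y hy => by
      have h2 : (0 : ℝ) < y := hy.1
      have h3 : (y : ℝ) < 1 := hy.2
      rw [Metric.mem_ball, Subtype.dist_eq, Real.dist_eq, abs_lt]
      constructor <;> linarith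
    refine le_trans ?_ (measure_mono this)
    rw [unitInterval.volume_Ioo]
    exact ENNReal.ofReal_le_ofReal (by simpa using h1)

theorem le_volume_ball_cube {d : ℕ} (x : Cube d) {r : ℝ} (h0 : 0 < r) (h1 : r ≤ 1) :
    ENNReal.ofReal r ^ d ≤ volume (Metric.ball x r) := by
  rw [ball_pi _ h0, volume_pi_pi]
  calc ENNReal.ofReal r ^ d = ∏ _i : Fin d, ENNReal.ofReal r := by simp
    _ ≤ _ := Finset.prod_le_prod' fun i _ => le_volume_ball_unitInterval (x i) h1

theorem le_volume_ball {p q : ℕ} (k : StateAction p q) {r : ℝ} (h0 : 0 < r) (h1 : r ≤ 1) :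
    ENNReal.ofReal (r ^ (p + q)) ≤ volume (Metric.ball k r) := by
  obtain ⟨s, a⟩ := k
  rw [← ball_prod_same, Measure.volume_eq_prod, Measure.prod_prod, ENNReal.ofReal_pow h0.le,
    pow_add]
  exact mul_le_mul' (le_volume_ball_cube s h0 h1) (le_volume_ball_cube a h0 h1)

end Ball

section RegularizingBall

variable {n : ℕ} {R : Seminorm ℝ (Fin n → ℝ)} {θ : ℝ}

theorem isCompact_regularizingBall (hR : ∀ α, R α = 0 → α = 0) :
    IsCompact {α | R α ≤ θ} := by
  have hc : Continuous R := continuousOn_univ.1 (R.convexOn.continuousOn isOpen_univ)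
  obtain ⟨c, hc0, hcR⟩ := exists_l1_le R hR
  refine Metric.isCompact_of_isClosed_isBounded (isClosed_le hc continuous_const) ?_
  refine (Metric.isBounded_closedBall (x := (0 : Fin n → ℝ)) (r := c * |θ|)).subset fun α hα => ?_
  rw [mem_closedBall_zero_iff]
  refine (pi_norm_le_iff_of_nonneg (by positivity)).2 fun i => ?_
  calc ‖α i‖ = |α i| := Real.norm_eq_abs _
    _ ≤ ∑ i, |α i| := Finset.single_le_sum (f := fun i => |α i|) (fun i _ => abs_nonneg (α i))
      (Finset.mem_univ i)
    _ ≤ c * R α := hcR α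
    _ ≤ c * |θ| := mul_le_mul_of_nonneg_left (le_trans hα (le_abs_self θ)) hc0

theorem convex_regularizingBall : Convex ℝ {α | R α ≤ θ} := by
  simpa using R.convexOn.convex_le θ

theorem sum_abs_le_normRatio (hR : ∀ α, R α = 0 → α = 0) (hθ : 0 < θ) {α : Fin n → ℝ}
    (hα : R α ≤ θ) : ∑ i, |α i| ≤ θ * normRatio R := by
  have h : ∑ i, |(θ⁻¹ • α) i| ≤ normRatio R := by
    refine le_csSup (bddAbove_normRatio R hR) ⟨θ⁻¹ • α, ?_, rfl⟩
    rw [map_smul_eq_mul, Real.norm_of_nonneg (by positivity), inv_mul_le_iff₀ hθ, mul_one]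
    exact hα
  have e : ∑ i, |(θ⁻¹ • α) i| = θ⁻¹ * ∑ i, |α i| := by
    rw [Finset.mul_sum]
    refine Finset.sum_congr rfl fun i _ => ?_
    rw [Pi.smul_apply, smul_eq_mul, abs_mul, abs_of_pos (by positivity)]
  rw [e, inv_mul_le_iff₀ hθ] at h
  exact h

theorem normRatio_pos (hn : 1 ≤ n) (hR : ∀ α, R α = 0 → α = 0) : 0 < normRatio R := by
  have h1 : (1 : Fin n → ℝ) ≠ 0 := fun h => by
    have := congrFun h ⟨0, hn⟩
    simp at this
  have hp : 0 < R 1 := lt_of_le_of_ne (apply_nonneg R _) fun h => h1 (hR _ h.symm)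
  have h := sum_abs_le_normRatio hR hp (le_refl (R 1))
  have h2 : (0 : ℝ) < ∑ i : Fin n, |(1 : Fin n → ℝ) i| := by
    simp only [Pi.one_apply, abs_one, Finset.sum_const, Finset.card_univ, Fintype.card_fin,
      nsmul_eq_mul, mul_one, Nat.cast_pos]
    exact hn
  exact pos_of_mul_pos_right (h2.trans_le h) hp.le

end RegularizingBall

theorem strictConcaveOn_sub_sum_sq {n : ℕ} {τ : ℝ} (hτ : 0 < τ) (c : ℝ) (w : Fin n → ℝ) :
    StrictConcaveOn ℝ Set.univ
      fun α : Fin n → ℝ => c - ∑ i, α i * w i - τ * ∑ i, α i ^ 2 := by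
  refine ⟨convex_univ, fun x _ y _ hxy a b ha hb hab => ?_⟩
  obtain ⟨i, hi⟩ := Function.ne_iff.1 hxy
  have hpos : 0 < ∑ i, (x i - y i) ^ 2 :=
    Finset.sum_pos' (fun i _ => sq_nonneg _)
      ⟨i, Finset.mem_univ i, by have := sub_ne_zero.2 hi; positivity⟩
  have h1 : ∑ i, (a • x + b • y) i * w i = a * ∑ i, x i * w i + b * ∑ i, y i * w i := by
    simp only [Finset.mul_sum, ← Finset.sum_add_distrib, Pi.add_apply, Pi.smul_apply, smul_eq_mul]
    exact Finset.sum_congr rfl fun i _ => by ring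
  have h2 : ∑ i, (a • x + b • y) i ^ 2
      = a * ∑ i, x i ^ 2 + b * ∑ i, y i ^ 2 - a * b * ∑ i, (x i - y i) ^ 2 := by
    simp only [Finset.mul_sum, ← Finset.sum_add_distrib, ← Finset.sum_sub_distrib, Pi.add_apply,
      Pi.smul_apply, smul_eq_mul]
    refine Finset.sum_congr rfl fun i _ => ?_
    obtain rfl : b = 1 - a := by linarith
    ring
  have h3 : 0 < τ * (a * b * ∑ i, (x i - y i) ^ 2) := by positivity
  simp only [smul_eq_mul]
  rw [h1, h2]
  obtain rfl : b = 1 - a := by linarith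
  nlinarith

section SampleSize

/-- The defining set must be shown nonempty, since `sInf ∅ = 0`. Below `m` trials the tail is 1,
which exceeds `β`. -/
theorem le_sampleSize {m : ℕ} {δ β : ℝ} (hβ0 : 0 < β) (hβ : β < 1) (hδ : 0 < δ) :
    m ≤ sampleSize m δ β ∧ binomialTail m (sampleSize m δ β) δ ≤ β := by
  have hne : {N : ℕ | binomialTail m N δ ≤ β}.Nonempty := by
    rcases lt_or_ge δ 1 with h | h
    · exact ((tendsto_binomialTail m hδ h).eventually_le_const hβ0).exists
    -- For `δ ≥ 1` the tail limit is unavailable, but with `m` trials the sum is `1 - δ ^ m ≤ 0`.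
    · refine ⟨m, ?_⟩
      have h1 := binomialTail_eq_one (Nat.lt_succ_self m) δ
      rw [binomialTail, Finset.sum_range_succ, ← binomialTail] at h1
      simp only [Nat.choose_self, Nat.cast_one, one_mul, Nat.sub_self, pow_zero, mul_one] at h1
      have := one_le_pow₀ h (n := m)
      simp only [Set.mem_ofPred_eq]
      linarith
  have hmem : binomialTail m (sampleSize m δ β) δ ≤ β := Nat.sInf_mem hne
  refine ⟨?_, hmem⟩
  by_contra! h
  rw [binomialTail_eq_one h] at hmem
  linarith

end SampleSize

end MDP

namespace MDP

/-! ### Program values as max-min values, and the passage from volume to size of violation. -/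

section Value

variable {p q n : ℕ} {ι : Type*} {Q : Kernel (StateAction p q) (Cube p)}
  {ψ : StateAction p q → ℝ} {u : Fin n → Cube p → ℝ} {R : Seminorm ℝ (Fin n → ℝ)} {θ : ℝ}

section

variable [Nonempty ι] (hψ : ∀ k, 0 ≤ ψ k) (hR : ∀ α, R α = 0 → α = 0) (hθ : 0 ≤ θ)
  {pt : ι → StateAction p q}
include hψ hR hθ

theorem Feasible.le_programValue {ρ : ℝ} {α : Fin n → ℝ} (h : Feasible Q ψ u R θ pt ρ α) :
    ρ ≤ programValue Q ψ u R θ pt := by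
  have := (isGLB_programValue Q ψ hψ u R hR θ hθ pt).1 ⟨ρ, α, h, rfl⟩
  linarith

theorem exists_feasible_of_lt_programValue {r : ℝ} (h : r < programValue Q ψ u R θ pt) :
    ∃ ρ α, Feasible Q ψ u R θ pt ρ α ∧ r < ρ := by
  obtain ⟨_, ⟨ρ, α, hf, rfl⟩, -, h2⟩ :=
    (isGLB_programValue Q ψ hψ u R hR θ hθ pt).exists_between (neg_lt_neg h)
  exact ⟨ρ, α, hf, neg_lt_neg_iff.1 h2⟩

theorem programValue_le {c : ℝ} (h : ∀ ρ α, Feasible Q ψ u R θ pt ρ α → ρ ≤ c) :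
    programValue Q ψ u R θ pt ≤ c := by
  refine le_of_forall_lt fun r hr => ?_
  obtain ⟨ρ, α, hf, hlt⟩ := exists_feasible_of_lt_programValue hψ hR hθ hr
  exact hlt.trans_le (h ρ α hf)

theorem semiInfiniteValue_le_programValue :
    semiInfiniteValue Q ψ u R θ ≤ programValue Q ψ u R θ pt :=
  programValue_le hψ hR hθ fun _ _ h =>
    Feasible.le_programValue hψ hR hθ ⟨fun j => h.1 (pt j), h.2⟩

theorem lt_programValue_iff [Finite ι] {r : ℝ} :
    r < programValue Q ψ u R θ pt ↔
      ∃ α, R α ≤ θ ∧ ∀ j, r < ψ (pt j) - ∑ i, α i * (u i (pt j).1 - act Q (u i) (pt j)) := by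
  constructor
  · intro h
    obtain ⟨ρ, α, hf, hlt⟩ := exists_feasible_of_lt_programValue hψ hR hθ h
    exact ⟨α, hf.2, fun j => by linarith [hf.1 j]⟩
  · rintro ⟨α, hα, hlt⟩
    obtain ⟨j₀, hj₀⟩ := Finite.exists_min fun j =>
      ψ (pt j) - ∑ i, α i * (u i (pt j).1 - act Q (u i) (pt j))
    refine (hlt j₀).trans_le (Feasible.le_programValue hψ hR hθ (α := α) ⟨fun j => ?_, hα⟩)
    linarith [hj₀ j]

end

theorem measurableSet_lt_sampledValue {N : ℕ} (hN : 0 < N) (hψ : ∀ k, 0 ≤ ψ k)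
    (hψc : Continuous ψ) (hw : ∀ i, Continuous fun k => u i k.1 - act Q (u i) k)
    (hR : ∀ α, R α = 0 → α = 0) (hθ : 0 ≤ θ) (r : ℝ) :
    MeasurableSet {ω : Fin N → StateAction p q | r < sampledValue Q ψ u R θ ω} := by
  have : Nonempty (Fin N) := ⟨⟨0, hN⟩⟩
  have e : {ω : Fin N → StateAction p q | r < sampledValue Q ψ u R θ ω}
      = ⋃ α ∈ {α | R α ≤ θ}, ⋂ j, {ω : Fin N → StateAction p q |
        r < ψ (ω j) - ∑ i, α i * (u i (ω j).1 - act Q (u i) (ω j))} := by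
    ext ω
    simp only [sampledValue, Set.mem_ofPred_eq, lt_programValue_iff hψ hR hθ, Set.mem_iUnion,
      Set.mem_iInter, exists_prop]
  rw [e]
  refine (isOpen_biUnion fun α _ => isOpen_iInter_of_finite fun j => ?_).measurableSet
  refine isOpen_lt continuous_const ?_
  refine (hψc.comp (continuous_apply j)).sub (continuous_finsetSum _ fun i _ => ?_)
  exact continuous_const.mul ((hw i).comp (continuous_apply j))

/-- Lipschitz continuity of the constraint functions `u_i(s) - Qu_i(s,a)`. -/
theorem abs_sub_act_sub_le {LQ : ℝ} (hLQ : 0 < LQ)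
    (hQ : ∀ (f : C(Cube p, ℝ)) (k k' : StateAction p q),
      |act Q f k - act Q f k'| ≤ LQ * ‖f‖ * dist k k')
    {f : Cube p → ℝ} {c : NNReal} (hf : LipschitzWith c f) (hf1 : lipNorm f = 1)
    (k k' : StateAction p q) :
    |(f k.1 - act Q f k) - (f k'.1 - act Q f k')| ≤ (max LQ 1 + 1) * dist k k' := by
  have h1 := abs_sub_le_lipNorm hf k.1 k'.1
  have h2 := hQ ⟨f, hf.continuous⟩ k k'
  have h3 : ‖(⟨f, hf.continuous⟩ : C(Cube p, ℝ))‖ ≤ 1 := by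
    rw [ContinuousMap.norm_le _ zero_le_one]
    intro x
    rw [Real.norm_eq_abs, ← hf1]
    exact abs_le_lipNorm hf.continuous x
  rw [hf1, one_mul] at h1
  simp only [ContinuousMap.coe_mk] at h2
  have h4 : dist k.1 k'.1 ≤ dist k k' := le_max_left _ _
  have h5 : LQ * ‖(⟨f, hf.continuous⟩ : C(Cube p, ℝ))‖ * dist k k' ≤ max LQ 1 * dist k k' := by
    refine mul_le_mul_of_nonneg_right ?_ dist_nonneg
    exact (mul_le_of_le_one_right hLQ.le h3).trans (le_max_left _ _)
  calc |(f k.1 - act Q f k) - (f k'.1 - act Q f k')|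
      = |(f k.1 - f k'.1) - (act Q f k - act Q f k')| := by congr 1; ring
    _ ≤ |f k.1 - f k'.1| + |act Q f k - act Q f k'| := abs_sub _ _
    _ ≤ (max LQ 1 + 1) * dist k k' := by linarith

theorem abs_slack_sub_le {X : Type*} [PseudoMetricSpace X] {w : Fin n → X → ℝ} {f : X → ℝ}
    {L c s : ℝ} (hL : 0 ≤ L) (hw : ∀ i k k', |w i k - w i k'| ≤ L * dist k k')
    (hf : ∀ k k', |f k - f k'| ≤ c * dist k k') {α : Fin n → ℝ} (hα : ∑ i, |α i| ≤ s) (k k' : X) :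
    |(f k - ∑ i, α i * w i k) - (f k' - ∑ i, α i * w i k')| ≤ (s * L + c) * dist k k' := by
  have h1 : |∑ i, α i * w i k - ∑ i, α i * w i k'| ≤ s * (L * dist k k') := by
    rw [← Finset.sum_sub_distrib]
    refine (Finset.abs_sum_le_sum_abs _ _).trans ?_
    refine le_trans ?_ (mul_le_mul_of_nonneg_right hα (mul_nonneg hL dist_nonneg))
    rw [Finset.sum_mul]
    refine Finset.sum_le_sum fun i _ => ?_
    rw [← mul_sub, abs_mul]
    exact mul_le_mul_of_nonneg_left (hw i k k') (abs_nonneg _)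
  calc |(f k - ∑ i, α i * w i k) - (f k' - ∑ i, α i * w i k')|
      = |(f k - f k') - (∑ i, α i * w i k - ∑ i, α i * w i k')| := by congr 1; ring
    _ ≤ |f k - f k'| + |∑ i, α i * w i k - ∑ i, α i * w i k'| := abs_sub _ _
    _ ≤ (s * L + c) * dist k k' := by linarith [hf k k']

/-- A function with Lipschitz constant `Λ` that is below a level only on a set of small measure
is nowhere far below that level. -/
theorem sub_le_of_volume_le {f : StateAction p q → ℝ} {Λ ε b : ℝ} (hΛ : 0 < Λ)
    (hf : ∀ k k', |f k - f k'| ≤ Λ * dist k k') (hε : 0 < ε) (hεΛ : ε < Λ) (hpq : p + q ≠ 0)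
    (hvol : volume {k | f k < b} ≤ ENNReal.ofReal ((Λ⁻¹ * ε) ^ (p + q))) (k : StateAction p q) :
    b - ε ≤ f k := by
  by_contra! hlt
  -- On the ball of radius `(b - f k)/Λ` the function stays below `b`. The cap 1 is required by the
  -- volume bound, and `ε < Λ` keeps the capped radius above `ε/Λ`.
  set r := min (Λ⁻¹ * (b - f k)) 1 with hr
  have hzr : Λ⁻¹ * ε < r := by
    refine lt_min (mul_lt_mul_of_pos_left (by linarith) (by positivity)) ?_
    rw [inv_mul_lt_iff₀ hΛ, mul_one]; exact hεΛ
  have h0 : 0 < Λ⁻¹ * ε := by positivity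
  have hsub : Metric.ball k r ⊆ {k | f k < b} := by
    intro k' hk'
    have h1 := abs_le.1 (hf k' k)
    have h2 : Λ * dist k' k < Λ * r := mul_lt_mul_of_pos_left hk' hΛ
    have h3 : Λ * r ≤ b - f k := by
      rw [← le_inv_mul_iff₀ hΛ]; exact min_le_left _ _
    simp only [Set.mem_ofPred_eq]
    linarith [h1.2]
  have h4 := (le_volume_ball k (h0.trans hzr) (min_le_right _ _)).trans
    ((measure_mono hsub).trans hvol)
  rw [ENNReal.ofReal_le_ofReal_iff (by positivity)] at h4
  exact absurd h4 (not_le.2 (pow_lt_pow_left₀ hzr h0.le hpq))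

end Value

end MDP

namespace MDP

/-! ### The tail bound by regularization. -/

section Main

variable {p q n : ℕ} {Q : Kernel (StateAction p q) (Cube p)}
  {ψ : StateAction p q → ℝ} {u : Fin n → Cube p → ℝ} {R : Seminorm ℝ (Fin n → ℝ)} {θ : ℝ}

/-- The tail bound for the optimality gap, at any level above `ε`. -/
theorem pi_lt_sampledValue_sub_le (hψ : ∀ k, 0 ≤ ψ k) (hψc : Continuous ψ)
    (hw : ∀ i, Continuous fun k => u i k.1 - act Q (u i) k)
    (hR : ∀ α, R α = 0 → α = 0) (hθ : 0 ≤ θ) {Λ ε : ℝ} (hε : 0 < ε) (hεΛ : ε < Λ)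
    (hslack : ∀ α, R α ≤ θ → ∀ k k', |(ψ k - ∑ i, α i * (u i k.1 - act Q (u i) k))
      - (ψ k' - ∑ i, α i * (u i k'.1 - act Q (u i) k'))| ≤ Λ * dist k k')
    (hpq : p + q ≠ 0) {N : ℕ} (hN : n + 1 ≤ N) {ε' : ℝ} (hε' : ε < ε') :
    Measure.pi (fun _ : Fin N => (volume : Measure (StateAction p q)))
      {ω | ε' < sampledValue Q ψ u R θ ω - semiInfiniteValue Q ψ u R θ}
      ≤ ENNReal.ofReal (binomialTail (n + 1) N ((Λ⁻¹ * ε) ^ (p + q))) := by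
  classical
  have hΛ : 0 < Λ := hε.trans hεΛ
  have : Nonempty (Fin N) := ⟨⟨0, by omega⟩⟩
  set w : Fin n → StateAction p q → ℝ := fun i k => u i k.1 - act Q (u i) k with hwdef
  set C : Set (Fin n → ℝ) := {α | R α ≤ θ} with hCdef
  have hC : IsCompact C := isCompact_regularizingBall hR
  have hconv : Convex ℝ C := convex_regularizingBall
  have hne : C.Nonempty := ⟨0, by simpa [hCdef] using hθ⟩
  -- `M` bounds every feasible `ρ`, so the base function `g₀` built from it costs nothing in the
  -- upper estimate.
  obtain ⟨M, hM⟩ : ∃ M, ∀ α ∈ C, ∀ k, ψ k - ∑ i, α i * w i k ≤ M := by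
    have hcont : Continuous fun x : (Fin n → ℝ) × StateAction p q =>
        ψ x.2 - ∑ i, x.1 i * w i x.2 := by
      refine (hψc.comp continuous_snd).sub (continuous_finsetSum _ fun i _ => ?_)
      exact ((continuous_apply i).comp continuous_fst).mul ((hw i).comp continuous_snd)
    obtain ⟨M, hM⟩ := (hC.prod isCompact_univ).bddAbove_image hcont.continuousOn
    exact ⟨M, fun α hα k => hM ⟨(α, k), ⟨hα, Set.mem_univ k⟩, rfl⟩⟩
  obtain ⟨c, hc⟩ : ∃ c, ∀ α ∈ C, ∑ i, α i ^ 2 ≤ c := by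
    obtain ⟨c, hc⟩ := hC.bddAbove_image (f := fun α : Fin n → ℝ => ∑ i, α i ^ 2)
      (by fun_prop : Continuous fun α : Fin n → ℝ => ∑ i, α i ^ 2).continuousOn
    exact ⟨c, fun α hα => hc ⟨α, hα, rfl⟩⟩
  have hc0 : 0 ≤ c := by
    obtain ⟨α, hα⟩ := hne
    exact (Finset.sum_nonneg fun i _ => sq_nonneg (α i)).trans (hc α hα)
  -- The label costs at most `τ` and the quadratic term at most `τ c`; together they use up exactly
  -- `ε' - ε`.
  set τ : ℝ := (ε' - ε) / (1 + c) with hτdef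
  have hτ : 0 < τ := div_pos (by linarith) (by linarith)
  have hτc : τ * (1 + c) = ε' - ε := div_mul_cancel₀ _ (by linarith)
  set g₀ : (Fin n → ℝ) → ℝ := fun α => M - ∑ i, α i * (0 : Fin n → ℝ) i - τ * ∑ i, α i ^ 2
    with hg₀def
  set g : StateAction p q × unitInterval → (Fin n → ℝ) → ℝ := fun z α =>
    ψ z.1 + τ * z.2 - ∑ i, α i * w i z.1 - τ * ∑ i, α i ^ 2 with hgdef
  have h₀ : Continuous g₀ := by fun_prop
  have hg : ∀ z, Continuous (g z) := fun z => by fun_prop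
  have hgz : ∀ α, Continuous fun z => g z α := fun α => by
    refine ((Continuous.add (hψc.comp continuous_fst) (by fun_prop)).sub
      (continuous_finsetSum _ fun i _ => ?_)).sub continuous_const
    exact continuous_const.mul ((hw i).comp continuous_fst)
  have s₀ : StrictConcaveOn ℝ Set.univ g₀ := strictConcaveOn_sub_sum_sq hτ _ _
  have sg : ∀ z, StrictConcaveOn ℝ Set.univ (g z) := fun z => strictConcaveOn_sub_sum_sq hτ _ _
  have hmono : ∀ k α, StrictMono fun s => g (k, s) α := fun k α s s' hs => by
    have : τ * (s : ℝ) < τ * s' := mul_lt_mul_of_pos_left hs hτ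
    simp only [hgdef]
    linarith
  set δ : ℝ := (Λ⁻¹ * ε) ^ (p + q) with hδ
  have hδ01 : δ ∈ unitInterval := by
    have h0 : 0 ≤ Λ⁻¹ * ε := by positivity
    refine ⟨pow_nonneg h0 _, pow_le_one₀ h0 ?_⟩
    rw [inv_mul_le_iff₀ hΛ, mul_one]; exact hεΛ.le
  have hbound := pi_violation_maxMin_le (volume : Measure (StateAction p q)) hC hconv hne h₀ hg
    s₀ sg hgz hmono (N := N) (by simpa using hN) ⟨δ, hδ01⟩
  simp only [Module.finrank_fin_fun] at hbound
  have hproj : MeasurePreserving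
      (fun (ω : Fin N → StateAction p q × unitInterval) (j : Fin N) => (ω j).1)
      (Measure.pi fun _ => (volume : Measure (StateAction p q)).prod
        (volume : Measure unitInterval)) (Measure.pi fun _ => volume) :=
    measurePreserving_pi _ _ fun _ => measurePreserving_fst
  have hmeas : MeasurableSet {ω : Fin N → StateAction p q |
      ε' < sampledValue Q ψ u R θ ω - semiInfiniteValue Q ψ u R θ} := by
    simp only [lt_sub_iff_add_lt]
    exact measurableSet_lt_sampledValue (by omega) hψ hψc hw hR hθ _
  rw [← hproj.measure_preimage hmeas.nullMeasurableSet]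
  refine (measure_mono fun ω hω => ?_).trans hbound
  by_contra hnot
  have hω' : ε' < sampledValue Q ψ u R θ (fun j => (ω j).1) - semiInfiniteValue Q ψ u R θ := hω
  refine (not_le.2 hω') ?_
  simp only [Set.mem_ofPred_eq, not_lt] at hnot
  set S := Finset.univ.image ω with hS
  obtain ⟨α, hα, hαS, hmax⟩ := exists_maxMin hC hne h₀ hg S
  set b := maxMin C g₀ g S with hb
  have hsq : 0 ≤ ∑ i, α i ^ 2 := Finset.sum_nonneg fun i _ => sq_nonneg (α i)
  -- Subtracting `τ`, the largest label contribution, gives points at which the constraint is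
  -- violated for every label, so this set times the whole label interval lies in the violation set.
  have hvol : volume {k | ψ k - ∑ i, α i * w i k < b + τ * ∑ i, α i ^ 2 - τ}
      ≤ ENNReal.ofReal ((Λ⁻¹ * ε) ^ (p + q)) := by
    refine le_trans ?_ hnot
    have h1 : volume {k | ψ k - ∑ i, α i * w i k < b + τ * ∑ i, α i ^ 2 - τ}
        = (volume : Measure (StateAction p q)).prod (volume : Measure unitInterval)
          ({k | ψ k - ∑ i, α i * w i k < b + τ * ∑ i, α i ^ 2 - τ} ×ˢ Set.univ) := by
      rw [Measure.prod_prod, measure_univ, mul_one]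
    rw [h1]
    refine measure_mono ?_
    rintro ⟨k, t⟩ ⟨hk, -⟩
    simp only [Set.mem_ofPred_eq] at hk ⊢
    rw [ne_eq, maxMin_insert_eq_iff hC hconv hne h₀ hg s₀ sg hα hαS, not_le]
    have : τ * (t : ℝ) ≤ τ := mul_le_of_le_one_right hτ.le t.2.2
    simp only [hgdef]
    linarith
  have hlow : b - τ - ε ≤ semiInfiniteValue Q ψ u R θ := by
    have hf : Feasible Q ψ u R θ (fun k : StateAction p q => k)
        (b + τ * ∑ i, α i ^ 2 - τ - ε) α := by
      refine ⟨fun k => ?_, hα⟩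
      have := sub_le_of_volume_le hΛ (hslack α hα) hε hεΛ hpq hvol k
      linarith
    have := Feasible.le_programValue hψ hR hθ hf
    have h2 : 0 ≤ τ * ∑ i, α i ^ 2 := mul_nonneg hτ.le hsq
    rw [semiInfiniteValue]
    linarith
  -- A feasible pair for the unperturbed sampled program gives a lower bound `ρ - τ ∑ α'_i²` for the
  -- perturbed minimum, because the labels are nonnegative.
  have hup : sampledValue Q ψ u R θ (fun j => (ω j).1) ≤ b + τ * c := by
    refine programValue_le hψ hR hθ fun ρ α' hf => ?_
    have h1 : ρ - τ * ∑ i, α' i ^ 2 ≤ pointwiseMin g₀ g S α' := by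
      refine le_pointwiseMin.2 ⟨?_, fun z hz => ?_⟩
      · obtain ⟨j⟩ := this
        have h2 := hf.1 j
        have h3 := hM α' hf.2 (ω j).1
        simp only [hg₀def, Pi.zero_apply, mul_zero, Finset.sum_const_zero]
        linarith
      · obtain ⟨j, -, rfl⟩ := Finset.mem_image.1 hz
        have h2 := hf.1 j
        have h3 : 0 ≤ τ * ((ω j).2 : ℝ) := mul_nonneg hτ.le (ω j).2.2.1
        simp only [hgdef]
        linarith
    have h2 := h1.trans (hmax α' hf.2)
    have h3 : τ * ∑ i, α' i ^ 2 ≤ τ * c := mul_le_mul_of_nonneg_left (hc α' hf.2) hτ.le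
    linarith
  linarith

end Main

end MDP

/-! ### Assembly, including the degenerate cases. -/

theorem mainTheorem7 (p q n : ℕ) (hn : 1 ≤ n)
    -- the transition law, Lipschitz continuous with constant `LQ`
    (Q : Kernel (MDP.StateAction p q) (MDP.Cube p)) [IsMarkovKernel Q]
    (LQ : ℝ) (hLQ : 0 < LQ)
    (hQ : ∀ (u : C(MDP.Cube p, ℝ)) (k k' : MDP.StateAction p q),
      |MDP.act Q u k - MDP.act Q u k'| ≤ LQ * ‖u‖ * dist k k')
    -- the one-stage cost
    (ψ : MDP.StateAction p q → ℝ) (hψ_nonneg : ∀ k, 0 ≤ ψ k) (hψ_lip : ∃ C, LipschitzWith C ψ)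
    -- the linearly independent, normalized Lipschitz basis functions
    (u : Fin n → MDP.Cube p → ℝ) (hu_lip : ∀ i, ∃ C, LipschitzWith C (u i))
    (hu_indep : LinearIndependent ℝ u) (hu_norm : ∀ i, MDP.lipNorm (u i) = 1)
    -- the norm on `ℝ^n` and the radius of the regularizing ball
    (R : Seminorm ℝ (Fin n → ℝ)) (hR : ∀ α, R α = 0 → α = 0) (θ : ℝ) (hθ : 0 < θ)
    (z : ℝ) (hz : z = (θ * MDP.normRatio R * (max LQ 1 + 1) + MDP.lipNorm ψ)⁻¹)
    (ε β : ℝ) (hε : ε ∈ Set.Ioo (0 : ℝ) 1) (hβ : β ∈ Set.Ioo (0 : ℝ) 1)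
    (N : ℕ) (hN : MDP.sampleSize (n + 1) ((z * ε) ^ (p + q)) β ≤ N) :
    1 - β ≤ (Measure.pi fun _ : Fin N => (volume : Measure (MDP.StateAction p q))).real
      {ω | 0 ≤ MDP.sampledValue Q ψ u R θ ω - MDP.semiInfiniteValue Q ψ u R θ ∧
        MDP.sampledValue Q ψ u R θ ω - MDP.semiInfiniteValue Q ψ u R θ ≤ ε} := by
  set Λ : ℝ := θ * MDP.normRatio R * (max LQ 1 + 1) + MDP.lipNorm ψ with hΛdef
  have hL : 0 < max LQ 1 + 1 := by positivity
  have hΛ : 0 < Λ := add_pos_of_pos_of_nonneg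
    (mul_pos (mul_pos hθ (MDP.normRatio_pos hn hR)) hL) (MDP.lipNorm_nonneg ψ)
  subst hz
  have hzε : 0 < Λ⁻¹ * ε := mul_pos (inv_pos.2 hΛ) hε.1
  obtain ⟨hm, htail⟩ := MDP.le_sampleSize (m := n + 1) hβ.1 hβ.2 (pow_pos hzε (p + q))
  have hnN : n + 1 ≤ N := hm.trans hN
  have : Nonempty (Fin N) := ⟨⟨0, by omega⟩⟩
  obtain ⟨cψ, hcψ⟩ := hψ_lip
  have hwl : ∀ i (k k' : MDP.StateAction p q), |(u i k.1 - MDP.act Q (u i) k)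
      - (u i k'.1 - MDP.act Q (u i) k')| ≤ (max LQ 1 + 1) * dist k k' := fun i k k' => by
    obtain ⟨c, hc⟩ := hu_lip i
    exact MDP.abs_sub_act_sub_le hLQ hQ hc (hu_norm i) k k'
  have hw : ∀ i, Continuous fun k : MDP.StateAction p q => u i k.1 - MDP.act Q (u i) k :=
    fun i => (LipschitzWith.of_dist_le_mul (K := ⟨max LQ 1 + 1, hL.le⟩) fun k k' => by
      rw [Real.dist_eq]; exact hwl i k k').continuous
  have hslack : ∀ α, R α ≤ θ → ∀ k k' : MDP.StateAction p q,
      |(ψ k - ∑ i, α i * (u i k.1 - MDP.act Q (u i) k))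
        - (ψ k' - ∑ i, α i * (u i k'.1 - MDP.act Q (u i) k'))| ≤ Λ * dist k k' := fun α hα =>
    MDP.abs_slack_sub_le (w := fun i (k : MDP.StateAction p q) => u i k.1 - MDP.act Q (u i) k)
      hL.le hwl (MDP.abs_sub_le_lipNorm hcψ) (MDP.sum_abs_le_normRatio hR hθ hα)
  have hnonneg : ∀ ω : Fin N → MDP.StateAction p q,
      0 ≤ MDP.sampledValue Q ψ u R θ ω - MDP.semiInfiniteValue Q ψ u R θ := fun ω =>
    sub_nonneg.2 (MDP.semiInfiniteValue_le_programValue hψ_nonneg hR hθ.le)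
  simp only [hnonneg, true_and]
  -- If `p + q = 0` or `ε ≥ Λ`, a constraint function varies by at most `ε` over all of `K`, so any
  -- single sample point gives the bound deterministically.
  by_cases hcase : p + q ≠ 0 ∧ ε < Λ
  · obtain ⟨hpq, hεΛ⟩ := hcase
    have hle1 : (Λ⁻¹ * ε) ^ (p + q) ≤ 1 := by
      refine pow_le_one₀ hzε.le ?_
      rw [inv_mul_le_iff₀ hΛ, mul_one]; exact hεΛ.le
    have hβN : binomialTail (n + 1) N ((Λ⁻¹ * ε) ^ (p + q)) ≤ β :=
      (binomialTail_antitone (n + 1) (pow_nonneg hzε.le _) hle1 hN).trans htail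
    have hmeas : MeasurableSet {ω : Fin N → MDP.StateAction p q |
        ε < MDP.sampledValue Q ψ u R θ ω - MDP.semiInfiniteValue Q ψ u R θ} := by
      simp only [lt_sub_iff_add_lt]
      exact MDP.measurableSet_lt_sampledValue (by omega) hψ_nonneg hcψ.continuous hw hR hθ.le _
    have hbad : Measure.pi (fun _ : Fin N => (volume : Measure (MDP.StateAction p q)))
        {ω | ε < MDP.sampledValue Q ψ u R θ ω - MDP.semiInfiniteValue Q ψ u R θ}
        ≤ ENNReal.ofReal β := by
      -- The tail bound holds at each level strictly above `ε` with the same right side; continuity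
      -- from below along `ε + 1/(m+1)` gives it at `ε`.
      have hU : {ω : Fin N → MDP.StateAction p q |
          ε < MDP.sampledValue Q ψ u R θ ω - MDP.semiInfiniteValue Q ψ u R θ}
          = ⋃ m : ℕ, {ω | ε + 1 / ((m : ℝ) + 1)
            < MDP.sampledValue Q ψ u R θ ω - MDP.semiInfiniteValue Q ψ u R θ} := by
        ext ω
        simp only [Set.mem_ofPred_eq, Set.mem_iUnion]
        constructor
        · intro h
          obtain ⟨m, hm⟩ := exists_nat_one_div_lt (sub_pos.2 h)
          exact ⟨m, by linarith⟩
        · rintro ⟨m, hm⟩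
          have : 0 < 1 / ((m : ℝ) + 1) := Nat.one_div_pos_of_nat
          linarith
      have hmono : Monotone fun m : ℕ => {ω : Fin N → MDP.StateAction p q |
          ε + 1 / ((m : ℝ) + 1)
            < MDP.sampledValue Q ψ u R θ ω - MDP.semiInfiniteValue Q ψ u R θ} := by
        intro m m' hmm ω hω
        have := Nat.one_div_le_one_div (α := ℝ) hmm
        simp only [Set.mem_ofPred_eq] at hω ⊢
        linarith
      rw [hU, hmono.measure_iUnion]
      refine iSup_le fun m => ?_
      exact (MDP.pi_lt_sampledValue_sub_le hψ_nonneg hcψ.continuous hw hR hθ.le hε.1 hεΛ hslack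
        hpq hnN (lt_add_of_pos_right _ Nat.one_div_pos_of_nat)).trans
        (ENNReal.ofReal_le_ofReal hβN)
    have hcompl := probReal_compl_eq_one_sub
      (μ := Measure.pi fun _ : Fin N => (volume : Measure (MDP.StateAction p q))) hmeas
    have hset : {ω : Fin N → MDP.StateAction p q |
        MDP.sampledValue Q ψ u R θ ω - MDP.semiInfiniteValue Q ψ u R θ ≤ ε}
        = {ω : Fin N → MDP.StateAction p q |
          ε < MDP.sampledValue Q ψ u R θ ω - MDP.semiInfiniteValue Q ψ u R θ}ᶜ := by
      ext ω; simp
    rw [hset, hcompl]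
    have := ENNReal.toReal_le_of_le_ofReal hβ.1.le hbad
    rw [← Measure.real] at this
    linarith
  · have hdist : ∀ k k' : MDP.StateAction p q, Λ * dist k k' ≤ ε := by
      intro k k'
      rcases not_and_or.1 hcase with h | h
      · obtain ⟨hp, hq⟩ : p = 0 ∧ q = 0 := by omega
        subst hp hq
        rw [Subsingleton.elim k k', dist_self, mul_zero]
        exact hε.1.le
      · have hd : ∀ {d : ℕ} (x y : MDP.Cube d), dist x y ≤ 1 := fun x y =>
          (dist_pi_le_iff zero_le_one).2 fun i => by
            rw [Subtype.dist_eq, Real.dist_eq, abs_le]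
            constructor <;> linarith [(x i).2.1, (x i).2.2, (y i).2.1, (y i).2.2]
        have h1 : dist k k' ≤ 1 := max_le (hd _ _) (hd _ _)
        exact (mul_le_of_le_one_right hΛ.le h1).trans (not_lt.1 h)
    have hall : ∀ ω : Fin N → MDP.StateAction p q,
        MDP.sampledValue Q ψ u R θ ω - MDP.semiInfiniteValue Q ψ u R θ ≤ ε := by
      intro ω
      rw [sub_le_iff_le_add']
      refine MDP.programValue_le hψ_nonneg hR hθ.le fun ρ α hf => ?_
      obtain ⟨j⟩ := this
      have h1 : MDP.Feasible Q ψ u R θ (fun k : MDP.StateAction p q => k) (ρ - ε) α := by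
        refine ⟨fun k => ?_, hf.2⟩
        have h2 := (abs_le.1 (hslack α hf.2 k (ω j))).1
        have h3 := hdist k (ω j)
        have h4 := hf.1 j
        linarith
      have h5 := MDP.Feasible.le_programValue hψ_nonneg hR hθ.le h1
      rw [MDP.semiInfiniteValue]
      linarith
    simp only [hall, Set.ofPred_true, probReal_univ]
    linarith [hβ.1]
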